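/- Let $S=\mathbb{C}[s_\alpha]$ be the polynomial ring in the $20$ variables $s_\alpha=s_{a_0a_1a_2a_3}$, where $\alpha=(a_0,a_1,a_2,a_3)\in\mathbb{Z}_{\ge 0}^4$ and $a_0+a_1+a_2+a_3=3$. Let $\phi_{(12)}$ be the automorphism of $S$ with $\phi_{(12)}(s_{a_0a_1a_2a_3})=s_{a_0a_2a_1a_3}$. Pfaffians of skew-symmetric matrices have their usual sign: $\operatorname{Pf}$ of the empty matrix is $1$, and $\operatorname{Pf}(M)=\sum_{j=2}^{2n}(-1)^j m_{1j}\operatorname{Pf}(M_{\hat 1\hat\jmath})$ for a $2n\times 2n$ matrix $M$ with $n\ge 1$, where $M_{\hat 1\hat\jmath}$ is $M$ without its rows and columns $1$ and $j$. Let $A_1$ be the skew-symmetric $11\times 11$ matrix $$A_1=\left(\begin{array}{ccccccccccc} 0 & s_{1020} & s_{1011} & s_{1101} & s_{1110} & s_{1200} & s_{2010} & s_{2100} & 0 & 0 & 0 \\ -s_{1020} & 0 & 0 & s_{0012} & 0 & s_{0111} & 0 & s_{1011} & s_{0120} & s_{0021} & s_{0030} \\ -s_{1011} & 0 & 0 &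 s_{0003} & 0 & s_{0102} & 0 & s_{1002} & s_{0111} & s_{0012} & s_{0021} \\ -s_{1101} & -s_{0012} & -s_{0003} & 0 & -s_{0102} & 0 & -s_{1002} & 0 & s_{0201} & s_{0102} & s_{0111} \\ -s_{1110} & 0 & 0 & s_{0102} & 0 & s_{0201} & 0 & s_{1101} & s_{0210} & s_{0111} & s_{0120} \\ -s_{1200} & -s_{0111} & -s_{0102} & 0 & -s_{0201} & 0 & -s_{1101} & 0 & s_{0300} & s_{0201} & s_{0210} \\ -s_{2010} & 0 & 0 & s_{1002} & 0 & s_{1101} & 0 & s_{2001} & s_{1110} & s_{1011} & s_{1020} \\ -s_{2100} & -s_{1011} & -s_{1002} & 0 & -s_{1101} & 0 & -s_{2001} & 0 & s_{1200} & s_{1101} & s_{1110} \\ 0 & -s_{0120} & -s_{0111} & -s_{0201} & -s_{0210} & -s_{0300} & -s_{1110} & -s_{1200} & 0 & 0 & 0 \\ 0 & -s_{0021} & -s_{0012} & -s_{0102} & -s_{0111} & -s_{0201} & -s_{1011} & -s_{1101} & 0 & 0 & 0 \\ 0 & -s_{0030} & -s_{0021} & -s_{0111} & -s_{0120} & -s_{0210}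 & -s_{1020} & -s_{1110} & 0 & 0 & 0 \end{array}\right)$$ and let $A_2$ and $B_2$ be the $10\times 11$ and the $10\times 10$ matrix $$A_2=\left(\begin{array}{ccccccccccc} s_{2001} & 0 & 0 & 0 & -s_{1002} & 0 & 0 & 0 & 0 & s_{1002} & -s_{1011} \\ -s_{2010} & 0 & 0 & 0 & s_{1011} & 0 & 0 & 0 & 0 & -s_{1011} & s_{1020} \\ s_{2100} & 0 & 0 & 0 & -s_{1101} & 0 & 0 & 0 & 0 & s_{1101} & -s_{1110} \\ s_{3000} & 0 & 0 & 0 & -s_{2001} & 0 & 0 & 0 & 0 & s_{2001} & -s_{2010} \\ 0 & 0 & 0 & 0 & 0 & 0 & 0 & 0 & -s_{2001} & 0 & 0 \\ 0 & 0 & 0 & 0 & 0 & 0 & 0 & 0 & s_{2010} & 0 & 0 \\ 0 & 0 & 0 & 0 & 0 & 0 & 0 & 0 & -s_{2100} & 0 & 0 \\ 0 & 0 & 0 & 0 & 0 & 0 & 0 & 0 & s_{3000} & 0 & 0 \\ 0 & 0 & 0 & -s_{2001} & s_{2010} & -s_{2100} & 0 & -s_{3000} & 0 & -2 s_{2010}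 & 0 \\ 0 & -s_{2010} & -s_{2001} & 0 & -2 s_{2100} & 0 & -s_{3000} & 0 & 0 & 2 s_{2100} & 0 \end{array}\right),$$ $$B_2=\left(\begin{array}{cccccccccc} s_{1002} & -s_{0012} & -s_{0102} & -s_{0003} & -s_{0201} & s_{0111} & 0 & 0 & 0 & 0 \\ -s_{1011} & s_{0021} & s_{0111} & s_{0012} & s_{0210} & -s_{0120} & 0 & 0 & 0 & 0 \\ s_{1101} & -s_{0111} & -s_{0201} & -s_{0102} & -s_{0300} & s_{0210} & 0 & 0 & 0 & 0 \\ s_{2001} & -s_{1011} & -s_{1101} & -s_{1002} & -s_{1200} & s_{1110} & 0 & 0 & 0 & 0 \\ 0 & 0 & 0 & 0 & s_{1101} & -s_{1011} & s_{0003} & s_{0102} & -s_{0012} & s_{1002} \\ 0 & 0 & 0 & 0 & -s_{1110} & s_{1020} & -s_{0012} & -s_{0111} & s_{0021} & -s_{1011} \\ 0 & 0 & 0 & 0 & s_{1200} & -s_{1110} & s_{0102} & s_{0201} & -s_{0111} & s_{1101} \\ 0 & 0 & 0 & 0 & -s_{2100} & s_{2010} & -s_{1002} & -s_{1101} & s_{1011}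 & -s_{2001} \\ -s_{2010} & s_{1020} & s_{1110} & s_{1011} & 0 & 0 & -s_{0111} & -s_{0210} & s_{0120} & -s_{1110} \\ s_{2100} & -s_{1110} & -s_{1200} & -s_{1101} & 0 & 0 & s_{0201} & s_{0300} & -s_{0210} & s_{1200} \end{array}\right).$$ Let $\xi\in S$ be the Pfaffian of the $8\times 8$ matrix obtained from $A_1$ by removing the rows and columns $1,7,8$. Define the quintic $$G=-s_{3000}\,\xi+G^a+G^b+\phi_{(12)}(G^b),$$ where $G^a$ is \begin{align*} &-(s_{2001} s_{1110} s_{0003} - s_{2001} s_{1002} s_{0111} - s_{1110} s_{1002}^{2} + s_{1101} s_{1011} s_{1002}) (s_{0300} s_{0030} - s_{0210} s_{0120})\\ &-2 (s_{1200} s_{1110} s_{1020} - s_{1110}^{3}) (s_{0111} s_{0003} - s_{0102} s_{0012}) -(s_{1200} s_{1020} s_{1002} - 2 s_{1110} s_{1101} s_{1011}) (s_{0201} s_{0021} + s_{0111}^{2})\\ &-s_{1110}^{2} s_{1002} (s_{0201} s_{0021} + 3 s_{0111}^{2}) \end{align*} and $G^b$ is \begin{align*} &-(s_{2100} s_{1200}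 s_{0120} - 2 s_{2100} s_{1110} s_{0210} + s_{2100} s_{1020} s_{0300} - s_{1200}^{2} s_{1020} + s_{1200} s_{1110}^{2}) (s_{0021} s_{0003} - s_{0012}^{2})\\ &+(s_{2100} s_{1200} s_{0111} - 2 s_{2100} s_{1101} s_{0210} + s_{2001} s_{1200} s_{0210} - s_{1200}^{2} s_{1011} + s_{1200} s_{1110} s_{1101}) (s_{0030} s_{0003} - s_{0021} s_{0012})\\ &-(s_{2100} s_{1200} s_{0102} - 2 s_{2100} s_{1101} s_{0201} + s_{2100} s_{1002} s_{0300} - s_{1200}^{2} s_{1002} + s_{1200} s_{1101}^{2}) (s_{0030} s_{0012} - s_{0021}^{2})\\ &+(2 s_{2100} s_{1002} s_{0102} - s_{1200} s_{1002}^{2} + s_{1101}^{2} s_{1002}) (s_{0210} s_{0030} - s_{0120}^{2})\\ &-s_{2100} \bigl\{ 2 s_{1110} (s_{0120} s_{0111} s_{0003} - s_{0120} s_{0102} s_{0012} - s_{0111}^{2} s_{0012} + s_{0111} s_{0102} s_{0021})\\ & -2 s_{1101} (s_{0120}^{2} s_{0003} - 2 s_{0120} s_{0111} s_{0012} + s_{0111}^{2}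 s_{0021})\\ & -s_{1020} (s_{0210} s_{0111} s_{0003} - s_{0210} s_{0102} s_{0012} - s_{0201} s_{0111} s_{0012} + s_{0201} s_{0102} s_{0021})\\ & -s_{1011} (s_{0300} s_{0030} s_{0003} - s_{0300} s_{0021} s_{0012} - s_{0210} s_{0120} s_{0003} + 2 s_{0210} s_{0111} s_{0012} - s_{0210} s_{0102} s_{0021} \\ & - s_{0201} s_{0120} s_{0012} + 2 s_{0201} s_{0111} s_{0021} - s_{0201} s_{0102} s_{0030} + 2 s_{0120} s_{0111} s_{0102} - 2 s_{0111}^{3})\\ & -s_{1002} (s_{0210} s_{0120} s_{0012} - 3 s_{0210} s_{0111} s_{0021} + s_{0201} s_{0120} s_{0021} - s_{0201} s_{0111} s_{0030} + 2 s_{0120} s_{0111}^{2}) \bigr\}\\ &-s_{2001} \bigl\{ s_{1200} (s_{0120}^{2} s_{0003} - s_{0120} s_{0111} s_{0012} - s_{0120} s_{0102} s_{0021} + s_{0111} s_{0102} s_{0030})-s_{1110} (s_{0300} s_{0021} s_{0012} - s_{0210} s_{0102} s_{0021})\\ & +s_{1002} (s_{0300} s_{0120} s_{0021} - s_{0210}^{2}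 s_{0021}) \bigr\}\\ &+(s_{1200} s_{1011} s_{1002} - s_{1110} s_{1101} s_{1002}) (s_{0210} s_{0021} + s_{0201} s_{0030} - 2 s_{0120} s_{0111})\\ &+(3 s_{1200} s_{1110} s_{1011} - s_{1200} s_{1101} s_{1020} - 2 s_{1110}^{2} s_{1101}) s_{0120} s_{0003}\\ &-(s_{1200} s_{1110} s_{1011} + s_{1200} s_{1101} s_{1020} - 2 s_{1110}^{2} s_{1101}) s_{0102} s_{0021} -2 (s_{1200} s_{1110} s_{1011} - s_{1200} s_{1101} s_{1020}) s_{0111} s_{0012}\\ &+2 (2 s_{1200} s_{1110} s_{1002} - s_{1200} s_{1101} s_{1011} - s_{1110} s_{1101}^{2}) s_{0111} s_{0021} -(s_{1200} s_{1110} s_{1002} - s_{1200} s_{1101} s_{1011}) s_{0102} s_{0030}\\ &-(3 s_{1200} s_{1110} s_{1002} - s_{1200} s_{1101} s_{1011} - 2 s_{1110} s_{1101}^{2}) s_{0120} s_{0012}+(s_{1200} s_{1020} s_{1002} + 2 s_{1110}^{2} s_{1002} - 2 s_{1110} s_{1101} s_{1011}) s_{0210} s_{0012}\\ & +s_{1200}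 s_{1011}^{2} s_{0111}^{2} -s_{1200} s_{1011}^{2} s_{0120} s_{0102} \end{align*} Let $\tilde A_1$ be the skew-symmetric $10\times 10$ matrix obtained from $A_1$ by removing the last row and the last column, and let $c_1$ be the last column of $A_1$ without its last entry. Let $\tilde A_2$ be $A_2$ without its last column, let $c_2$ be the last column of $A_2$, and let $\tilde B_2$ be $B_2$ without its first column. Set $$L=\begin{pmatrix}\tilde A_1&c_1&O\\ \tilde A_2&c_2&\tilde B_2\end{pmatrix},$$ a $20\times 20$ matrix, where $O$ is the $10\times 9$ zero matrix. Then $\operatorname{Pf}(\tilde A_1)\neq 0$, and in the fraction field of $S$ $$G=-\frac{\det(L)}{\operatorname{Pf}(\tilde A_1)^3}.$$ -/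

import Mathlib

open MvPolynomial

namespace VeroneseSecant

/-- Exponent vectors `(a₀, a₁, a₂, a₃)` of the cubic monomials in `t₀, t₁, t₂, t₃`:
the labels of the homogeneous coordinates `s_α` of `ℙ¹⁹`. -/
abbrev Index : Type := {α : Fin 4 → ℕ // ∑ i, α i = 3}

/-- The coordinate ring `ℂ[s_α]` of `ℙ¹⁹`. -/
abbrev S : Type := MvPolynomial Index ℂ

/-- The coordinate `s_{abcd}`. -/
noncomputable def s (a b c d : ℕ) (h : a + b + c + d = 3 := by rfl) : S :=
  X ⟨![a, b, c, d], by rw [Fin.sum_univ_four]; exact h⟩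

/-- The automorphism `φ_τ` of `ℂ[s_α]`, sending `s_{(a₀, …, a₃)}` to
`s_{(a_{τ 0}, …, a_{τ 3})}`. -/
noncomputable def phi (τ : Equiv.Perm (Fin 4)) : S →ₐ[ℂ] S :=
  rename fun α : Index => ⟨fun i => α.1 (τ i), by rw [Equiv.sum_comp τ α.1]; exact α.2⟩

/-- The Pfaffian of a `2n × 2n` skew-symmetric matrix, by expansion along the first row:
`Pf(A) = ∑_{j = 2}^{2n} (-1)^j a_{1j} Pf(A_{1j})`, where `A_{1j}` is `A` without its rows
and columns `1` and `j`. In the code the summation index counts from `0`, at the second column. -/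
def pf {R : Type*} [CommRing R] : (n : ℕ) → Matrix (Fin (2 * n)) (Fin (2 * n)) R → R
  | 0, _ => 1
  | n + 1, A => ∑ j : Fin (2 * n + 1), (-1) ^ (j : ℕ) * A 0 j.succ *
      pf n (A.submatrix (fun i => (j.succAbove i).succ) (fun i => (j.succAbove i).succ))

/-- The `11 × 11` skew-symmetric matrix `A₁`. Its columns carry the labels
2445, 3534, 3543, 3453, 3444(1), 3354, 2544, 2454, 3345, 3444(2), 3435, and its rows
4554, 3465, 3456, 3546, 3555, 3645, 4455, 4545, 3654, 3555, 3564, in this order. -/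
noncomputable def A₁ : Matrix (Fin 11) (Fin 11) S :=
  !![0, s 1 0 2 0, s 1 0 1 1, s 1 1 0 1, s 1 1 1 0, s 1 2 0 0, s 2 0 1 0, s 2 1 0 0, 0, 0, 0;
    -s 1 0 2 0, 0, 0, s 0 0 1 2, 0, s 0 1 1 1, 0, s 1 0 1 1, s 0 1 2 0, s 0 0 2 1, s 0 0 3 0;
    -s 1 0 1 1, 0, 0, s 0 0 0 3, 0, s 0 1 0 2, 0, s 1 0 0 2, s 0 1 1 1, s 0 0 1 2, s 0 0 2 1;
    -s 1 1 0 1, -s 0 0 1 2, -s 0 0 0 3, 0, -s 0 1 0 2, 0, -s 1 0 0 2, 0, s 0 2 0 1, s 0 1 0 2, s 0 1 1 1;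
    -s 1 1 1 0, 0, 0, s 0 1 0 2, 0, s 0 2 0 1, 0, s 1 1 0 1, s 0 2 1 0, s 0 1 1 1, s 0 1 2 0;
    -s 1 2 0 0, -s 0 1 1 1, -s 0 1 0 2, 0, -s 0 2 0 1, 0, -s 1 1 0 1, 0, s 0 3 0 0, s 0 2 0 1, s 0 2 1 0;
    -s 2 0 1 0, 0, 0, s 1 0 0 2, 0, s 1 1 0 1, 0, s 2 0 0 1, s 1 1 1 0, s 1 0 1 1, s 1 0 2 0;
    -s 2 1 0 0, -s 1 0 1 1, -s 1 0 0 2, 0, -s 1 1 0 1, 0, -s 2 0 0 1, 0, s 1 2 0 0, s 1 1 0 1, s 1 1 1 0;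
    0, -s 0 1 2 0, -s 0 1 1 1, -s 0 2 0 1, -s 0 2 1 0, -s 0 3 0 0, -s 1 1 1 0, -s 1 2 0 0, 0, 0, 0;
    0, -s 0 0 2 1, -s 0 0 1 2, -s 0 1 0 2, -s 0 1 1 1, -s 0 2 0 1, -s 1 0 1 1, -s 1 1 0 1, 0, 0, 0;
    0, -s 0 0 3 0, -s 0 0 2 1, -s 0 1 1 1, -s 0 1 2 0, -s 0 2 1 0, -s 1 0 2 0, -s 1 1 1 0, 0, 0, 0]

theorem A₁_transpose : A₁.transpose = -A₁ := by
  ext i j : 2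
  fin_cases i <;> fin_cases j <;> simp [A₁]

/-- The `10 × 11` matrix `A₂`. Its columns carry the same labels as those of `A₁`, and its rows
4446, 4455(2), 4545(2), 5445, 5346, 5355, 5445, 6345, 5454, 5544. -/
noncomputable def A₂ : Matrix (Fin 10) (Fin 11) S :=
  !![s 2 0 0 1, 0, 0, 0, -s 1 0 0 2, 0, 0, 0, 0, s 1 0 0 2, -s 1 0 1 1;
    -s 2 0 1 0, 0, 0, 0, s 1 0 1 1, 0, 0, 0, 0, -s 1 0 1 1, s 1 0 2 0;
    s 2 1 0 0, 0, 0, 0, -s 1 1 0 1, 0, 0, 0, 0, s 1 1 0 1, -s 1 1 1 0;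
    s 3 0 0 0, 0, 0, 0, -s 2 0 0 1, 0, 0, 0, 0, s 2 0 0 1, -s 2 0 1 0;
    0, 0, 0, 0, 0, 0, 0, 0, -s 2 0 0 1, 0, 0;
    0, 0, 0, 0, 0, 0, 0, 0, s 2 0 1 0, 0, 0;
    0, 0, 0, 0, 0, 0, 0, 0, -s 2 1 0 0, 0, 0;
    0, 0, 0, 0, 0, 0, 0, 0, s 3 0 0 0, 0, 0;
    0, 0, 0, -s 2 0 0 1, s 2 0 1 0, -s 2 1 0 0, 0, -s 3 0 0 0, 0, -2 * s 2 0 1 0, 0;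
    0, -s 2 0 1 0, -s 2 0 0 1, 0, -2 * s 2 1 0 0, 0, -s 3 0 0 0, 0, 0, 2 * s 2 1 0 0, 0]

/-- The `10 × 10` matrix `B₂`. Its rows carry the same labels as those of `A₂`, and its columns
3444(3), 4434, 4344(1), 4443, 4245, 4335, 5343, 5244, 5334, 4344(2). -/
noncomputable def B₂ : Matrix (Fin 10) (Fin 10) S :=
  !![s 1 0 0 2, -s 0 0 1 2, -s 0 1 0 2, -s 0 0 0 3, -s 0 2 0 1, s 0 1 1 1, 0, 0, 0, 0;
    -s 1 0 1 1, s 0 0 2 1, s 0 1 1 1, s 0 0 1 2, s 0 2 1 0, -s 0 1 2 0, 0, 0, 0, 0;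
    s 1 1 0 1, -s 0 1 1 1, -s 0 2 0 1, -s 0 1 0 2, -s 0 3 0 0, s 0 2 1 0, 0, 0, 0, 0;
    s 2 0 0 1, -s 1 0 1 1, -s 1 1 0 1, -s 1 0 0 2, -s 1 2 0 0, s 1 1 1 0, 0, 0, 0, 0;
    0, 0, 0, 0, s 1 1 0 1, -s 1 0 1 1, s 0 0 0 3, s 0 1 0 2, -s 0 0 1 2, s 1 0 0 2;
    0, 0, 0, 0, -s 1 1 1 0, s 1 0 2 0, -s 0 0 1 2, -s 0 1 1 1, s 0 0 2 1, -s 1 0 1 1;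
    0, 0, 0, 0, s 1 2 0 0, -s 1 1 1 0, s 0 1 0 2, s 0 2 0 1, -s 0 1 1 1, s 1 1 0 1;
    0, 0, 0, 0, -s 2 1 0 0, s 2 0 1 0, -s 1 0 0 2, -s 1 1 0 1, s 1 0 1 1, -s 2 0 0 1;
    -s 2 0 1 0, s 1 0 2 0, s 1 1 1 0, s 1 0 1 1, 0, 0, -s 0 1 1 1, -s 0 2 1 0, s 0 1 2 0, -s 1 1 1 0;
    s 2 1 0 0, -s 1 1 1 0, -s 1 2 0 0, -s 1 1 0 1, 0, 0, s 0 2 0 1, s 0 3 0 0, -s 0 2 1 0, s 1 2 0 0]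

/-- The quartic `ξ`: the Pfaffian of `A₁` without the columns 2445, 2544, 2454 and the
rows 4554, 4455, 4545 (positions 0, 6, 7). -/
noncomputable def ξ : S :=
  pf 4 (A₁.submatrix ![1, 2, 3, 4, 5, 8, 9, 10] ![1, 2, 3, 4, 5, 8, 9, 10])

/-- The quintic `Gᵃ`. -/
noncomputable def Ga : S :=
  -(s 2 0 0 1 * s 1 1 1 0 * s 0 0 0 3 - s 2 0 0 1 * s 1 0 0 2 * s 0 1 1 1 - s 1 1 1 0 * s 1 0 0 2 ^ 2 + s 1 1 0 1 * s 1 0 1 1 * s 1 0 0 2) * (s 0 3 0 0 * s 0 0 3 0 - s 0 2 1 0 * s 0 1 2 0)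
    - 2 * (s 1 2 0 0 * s 1 1 1 0 * s 1 0 2 0 - s 1 1 1 0 ^ 3) * (s 0 1 1 1 * s 0 0 0 3 - s 0 1 0 2 * s 0 0 1 2)
    - (s 1 2 0 0 * s 1 0 2 0 * s 1 0 0 2 - 2 * s 1 1 1 0 * s 1 1 0 1 * s 1 0 1 1) * (s 0 2 0 1 * s 0 0 2 1 + s 0 1 1 1 ^ 2)
    - s 1 1 1 0 ^ 2 * s 1 0 0 2 * (s 0 2 0 1 * s 0 0 2 1 + 3 * s 0 1 1 1 ^ 2)

/-- The quintic `Gᵇ`. -/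
noncomputable def Gb : S :=
  -(s 2 1 0 0 * s 1 2 0 0 * s 0 1 2 0 - 2 * s 2 1 0 0 * s 1 1 1 0 * s 0 2 1 0 + s 2 1 0 0 * s 1 0 2 0 * s 0 3 0 0 - s 1 2 0 0 ^ 2 * s 1 0 2 0 + s 1 2 0 0 * s 1 1 1 0 ^ 2) * (s 0 0 2 1 * s 0 0 0 3 - s 0 0 1 2 ^ 2)
    + (s 2 1 0 0 * s 1 2 0 0 * s 0 1 1 1 - 2 * s 2 1 0 0 * s 1 1 0 1 * s 0 2 1 0 + s 2 0 0 1 * s 1 2 0 0 * s 0 2 1 0 - s 1 2 0 0 ^ 2 * s 1 0 1 1 + s 1 2 0 0 * s 1 1 1 0 * s 1 1 0 1) * (s 0 0 3 0 * s 0 0 0 3 - s 0 0 2 1 * s 0 0 1 2)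
    - (s 2 1 0 0 * s 1 2 0 0 * s 0 1 0 2 - 2 * s 2 1 0 0 * s 1 1 0 1 * s 0 2 0 1 + s 2 1 0 0 * s 1 0 0 2 * s 0 3 0 0 - s 1 2 0 0 ^ 2 * s 1 0 0 2 + s 1 2 0 0 * s 1 1 0 1 ^ 2) * (s 0 0 3 0 * s 0 0 1 2 - s 0 0 2 1 ^ 2)
    + (2 * s 2 1 0 0 * s 1 0 0 2 * s 0 1 0 2 - s 1 2 0 0 * s 1 0 0 2 ^ 2 + s 1 1 0 1 ^ 2 * s 1 0 0 2) * (s 0 2 1 0 * s 0 0 3 0 - s 0 1 2 0 ^ 2)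
    - s 2 1 0 0 * (
    2 * s 1 1 1 0 * (s 0 1 2 0 * s 0 1 1 1 * s 0 0 0 3 - s 0 1 2 0 * s 0 1 0 2 * s 0 0 1 2 - s 0 1 1 1 ^ 2 * s 0 0 1 2 + s 0 1 1 1 * s 0 1 0 2 * s 0 0 2 1)
    - 2 * s 1 1 0 1 * (s 0 1 2 0 ^ 2 * s 0 0 0 3 - 2 * s 0 1 2 0 * s 0 1 1 1 * s 0 0 1 2 + s 0 1 1 1 ^ 2 * s 0 0 2 1)
    - s 1 0 2 0 * (s 0 2 1 0 * s 0 1 1 1 * s 0 0 0 3 - s 0 2 1 0 * s 0 1 0 2 * s 0 0 1 2 - s 0 2 0 1 * s 0 1 1 1 * s 0 0 1 2 + s 0 2 0 1 * s 0 1 0 2 * s 0 0 2 1)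
    - s 1 0 1 1 * (s 0 3 0 0 * s 0 0 3 0 * s 0 0 0 3 - s 0 3 0 0 * s 0 0 2 1 * s 0 0 1 2 - s 0 2 1 0 * s 0 1 2 0 * s 0 0 0 3 + 2 * s 0 2 1 0 * s 0 1 1 1 * s 0 0 1 2 - s 0 2 1 0 * s 0 1 0 2 * s 0 0 2 1
    - s 0 2 0 1 * s 0 1 2 0 * s 0 0 1 2 + 2 * s 0 2 0 1 * s 0 1 1 1 * s 0 0 2 1 - s 0 2 0 1 * s 0 1 0 2 * s 0 0 3 0 + 2 * s 0 1 2 0 * s 0 1 1 1 * s 0 1 0 2 - 2 * s 0 1 1 1 ^ 3)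
    - s 1 0 0 2 * (s 0 2 1 0 * s 0 1 2 0 * s 0 0 1 2 - 3 * s 0 2 1 0 * s 0 1 1 1 * s 0 0 2 1 + s 0 2 0 1 * s 0 1 2 0 * s 0 0 2 1 - s 0 2 0 1 * s 0 1 1 1 * s 0 0 3 0 + 2 * s 0 1 2 0 * s 0 1 1 1 ^ 2)
    )
    - s 2 0 0 1 * (
    s 1 2 0 0 * (s 0 1 2 0 ^ 2 * s 0 0 0 3 - s 0 1 2 0 * s 0 1 1 1 * s 0 0 1 2 - s 0 1 2 0 * s 0 1 0 2 * s 0 0 2 1 + s 0 1 1 1 * s 0 1 0 2 * s 0 0 3 0) - s 1 1 1 0 * (s 0 3 0 0 * s 0 0 2 1 * s 0 0 1 2 - s 0 2 1 0 * s 0 1 0 2 * s 0 0 2 1)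
    + s 1 0 0 2 * (s 0 3 0 0 * s 0 1 2 0 * s 0 0 2 1 - s 0 2 1 0 ^ 2 * s 0 0 2 1)
    )
    + (s 1 2 0 0 * s 1 0 1 1 * s 1 0 0 2 - s 1 1 1 0 * s 1 1 0 1 * s 1 0 0 2) * (s 0 2 1 0 * s 0 0 2 1 + s 0 2 0 1 * s 0 0 3 0 - 2 * s 0 1 2 0 * s 0 1 1 1)
    + (3 * s 1 2 0 0 * s 1 1 1 0 * s 1 0 1 1 - s 1 2 0 0 * s 1 1 0 1 * s 1 0 2 0 - 2 * s 1 1 1 0 ^ 2 * s 1 1 0 1) * s 0 1 2 0 * s 0 0 0 3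
    - (s 1 2 0 0 * s 1 1 1 0 * s 1 0 1 1 + s 1 2 0 0 * s 1 1 0 1 * s 1 0 2 0 - 2 * s 1 1 1 0 ^ 2 * s 1 1 0 1) * s 0 1 0 2 * s 0 0 2 1
    - 2 * (s 1 2 0 0 * s 1 1 1 0 * s 1 0 1 1 - s 1 2 0 0 * s 1 1 0 1 * s 1 0 2 0) * s 0 1 1 1 * s 0 0 1 2
    + 2 * (2 * s 1 2 0 0 * s 1 1 1 0 * s 1 0 0 2 - s 1 2 0 0 * s 1 1 0 1 * s 1 0 1 1 - s 1 1 1 0 * s 1 1 0 1 ^ 2) * s 0 1 1 1 * s 0 0 2 1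
    - (s 1 2 0 0 * s 1 1 1 0 * s 1 0 0 2 - s 1 2 0 0 * s 1 1 0 1 * s 1 0 1 1) * s 0 1 0 2 * s 0 0 3 0
    - (3 * s 1 2 0 0 * s 1 1 1 0 * s 1 0 0 2 - s 1 2 0 0 * s 1 1 0 1 * s 1 0 1 1 - 2 * s 1 1 1 0 * s 1 1 0 1 ^ 2) * s 0 1 2 0 * s 0 0 1 2 + (s 1 2 0 0 * s 1 0 2 0 * s 1 0 0 2 + 2 * s 1 1 1 0 ^ 2 * s 1 0 0 2 - 2 * s 1 1 1 0 * s 1 1 0 1 * s 1 0 1 1) * s 0 2 1 0 * s 0 0 1 2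
    + s 1 2 0 0 * s 1 0 1 1 ^ 2 * s 0 1 1 1 ^ 2
    - s 1 2 0 0 * s 1 0 1 1 ^ 2 * s 0 1 2 0 * s 0 1 0 2

/-- The quintic `G`, of weight `(3, 4, 4, 4)`; `(12)` is the transposition of the symbols `1`
and `2` of `{0, 1, 2, 3}`. The sign of `s₃₀₀₀ ξ` is the one for which `G` vanishes on the fourth secant
variety of `v₃(ℙ³)`, with Pfaffians normalized as above. -/
noncomputable def G : S :=
  -(s 3 0 0 0 * ξ) + Ga + Gb + phi (Equiv.swap 1 2) Gb

/-- `Ã₁`: `A₁` without its last column (3435) and its last row (3564). -/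
noncomputable def At₁ : Matrix (Fin 10) (Fin 10) S :=
  A₁.submatrix Fin.castSucc Fin.castSucc

/-- `c₁`: the last column (3435) of `A₁`, without the entry in the last row (3564). -/
noncomputable def c₁ : Fin 10 → S := fun i => A₁ i.castSucc (Fin.last 10)

/-- `Ã₂`: `A₂` without its last column (3435). -/
noncomputable def At₂ : Matrix (Fin 10) (Fin 10) S :=
  A₂.submatrix id Fin.castSucc

/-- `c₂`: the last column (3435) of `A₂`. -/
noncomputable def c₂ : Fin 10 → S := fun i => A₂ i (Fin.last 10)

/-- `B̃₂`: `B₂` without its first column (3444(3)). -/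
noncomputable def Bt₂ : Matrix (Fin 10) (Fin 9) S :=
  B₂.submatrix id Fin.succ

/-- The `20 × 20` matrix `L = [Ã₁ c₁ O; Ã₂ c₂ B̃₂]`. The twenty row positions are
`Fin 10 ⊕ Fin 10` (the upper ten, then the lower ten), and so are the twenty column positions:
the first ten are those of `Ã₁`, the last ten consist of the column `c₁`, `c₂` followed by the nine
columns of `O`, `B̃₂`. -/
noncomputable def L : Matrix (Fin 10 ⊕ Fin 10) (Fin 10 ⊕ Fin 10) S :=
  Matrix.fromBlocks
    At₁ (Matrix.of fun i => Fin.cons (c₁ i) (0 : Fin 9 → S))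
    At₂ (Matrix.of fun i => Fin.cons (c₂ i) (Bt₂ i))

end VeroneseSecant

open Matrix

set_option linter.unusedVariables false

namespace VeroneseSecant

/-! The formula is Cramer's rule for a vector that `L` sends to a multiple of one column. Since `A₁`
is skew of odd size, it has a kernel vector x, namely its signed maximal sub-Pfaffians; the last
entry is Pf(Ã₁). The system B₂y = A₂x turns out to have a polynomial solution y whose first entry is
-G.

Removing the first column from B₂y = A₂x shows that `L` maps the vector made of x and the negated
tail of y to y₀ times the column (0, first column of B₂). Cramer's rule at the column of c₁, c₂ then
gives det(L)·Pf(Ã₁) = y₀·det(Ã₁)·det(B₂) (`det_bordered_mul`).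

Both determinants on the right equal Pf(Ã₁)²: Ã₁ and B₂ are, after elementary operations, two signed
copies of one 4 × 4 catalecticant Q bordered by two rows and two columns, and the Schur complement
of size 2 is explicit (`det_genA₁`, `det_genB₂`). Hence det(L)·Pf(Ã₁) = -G·Pf(Ã₁)⁴, and one factor
cancels because Pf(Ã₁) ≠ 0.

The polynomial inputs are `genA₁_mulVec_kernelA₁` and `genB₂_mulVec_liftB₂`. Few of their rows are
expanded; the symmetric group on the four variables supplies the others. It acts by permuting the
twenty arguments of the quintics, which is why everything is stated for arbitrary ring elements a,
…, u. -/

/-! ### Quintics and matrices in general coordinates. -/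

/-- A quintic of weight `(3, 4, 3, 5)`. Here and below the letters `a, …, u` (without `s`) stand for
the twenty coordinates `s_{3000}, s_{2100}, s_{2010}, …, s_{0003}` in descending lexicographic
order. -/
def quintic3435 {R : Type*} [CommRing R]
    (a b c d e f g h i j k l m n o p q r t u : R) : R :=
  i * (m * (g * (2 * f * t + g * r + h * p - 3 * i * o + j * n) - i * (e * t + f * p - i * m + j *
    l) + o * (b * t + c * p + d * o + 2 * f * j) + u * (-b * n + c * l + e * h - f ^ 2) - m * (c *
    t + d * r + h * j) + d * l * t + e * j * r) - p * (e * (g * r + h * p - 2 * i * o + j * n) - k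
    * (c * t + d * r + h * j - i ^ 2) + l * (b * t + c * p + d * o - 2 * g * i) + b * (-n * p + o
    ^ 2) + f * (-f * p + 2 * g * o) + g ^ 2 * n) - k * (g * (h * u - i * t + j * r) + o * (c * u +
    d * t - i * j) - f * i * u + 2 * f * j * t) + e * (j * (2 * l * t - 2 * o ^ 2) + g * n * u - i
    * l * u) + g * (-2 * g * l * t + 2 * g * o ^ 2) + b * l * o * u) + g * (o * (d * (l * t + m *
    r + n * p - o ^ 2) + u * (b * n - c * l - e * h + f ^ 2) + j * (e * r - g * n + h * m) + b *
    (-o * t + p * r) + c * m * t - g ^ 2 * r) - t * (n * (b * p + d * m + e * j - g ^ 2) - h * (e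
    * p - g * m + j * k) + c * (k * t - l * p) - b * l * t + f ^ 2 * p) - r * (l * (b * u + d * p
    - g * j) + c * (-k * u + m * p) - f * g * p + 2 * f * j * m) + f * (-g * n * u + 2 * j * n *
    p) + g * h * l * u - 2 * h * j * l * p) + j * (-o * (b * (l * t + m * r + n * p - o ^ 2) - c *
    (k * t + l * p - m * o) - e * (h * p + j * n) + f ^ 2 * p + h * j * k) + m * (t * (b * n - c *
    l - e * h + f ^ 2) + j * (-f * n + h * l) + c * m * r) + r * (j * (-e * l + f * k) + b * l * p
    - c * k * p)) + d * (p * (f * (m * r - n * p + o ^ 2) - h * (k * t - l * p + m * o) + e * n *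
    t - e * o * r) + u * (e * (l * r - n * o) + f * (-k * r + m * n) + h * k * o - h * l * m) + t
    * (e * (-l * t + o ^ 2) + f * (k * t - 2 * m * o) + h * m ^ 2)) - b * (f * (m * (-r * u + t ^
    2) + o * (o * u - 2 * p * t) + p ^ 2 * r)) + c * (e * (m * (-r * u + t ^ 2) + o * (o * u - 2 *
    p * t) + p ^ 2 * r))

/-- A quintic of weight `(4, 2, 4, 5)`. -/
def quintic4245 {R : Type*} [CommRing R]
    (a b c d e f g h i j k l m n o p q r t u : R) : R :=
  i * (-p * (c * (-2 * f * t + 3 * g * r + h * p - 2 * i * o + j * n) + d * (-2 * f * r + g * q +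
    3 * h * o - i * n) + a * (n * t + o * r - p * q) + b * (h * t - i * r + j * q) + f * (-2 * h *
    j + 2 * i ^ 2) - 2 * g * h * i) + g * (-t * (b * r - 2 * c * o + d * n - 2 * f * i + 2 * g *
    h) + o * (2 * d * r + 2 * h * j - 2 * i ^ 2) + u * (b * q + c * n - 2 * f * h) - 2 * f * j * r
    + g * i * r) + m * (-i * (2 * c * t + 2 * d * r + 2 * h * j - i ^ 2) + a * (-q * u + r * t) +
    c * (h * u + 3 * j * r) + 3 * d * h * t + d * j * q) - o * (j * (b * r + 2 * c * o + d * n - 2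
    * f * i) - u * (a * n + b * h - 2 * c * f) + 2 * d * f * t - d * i * o) + b * (-i * n * u + 2
    * j * n * t) + f ^ 2 * i * u - 2 * f ^ 2 * j * t) + d * (-r * (p * (b * r - c * o + d * n - g
    * h) + m * (c * t - d * r + h * j) - b * (n * u + o * t) + g * (g * r - j * n) + f ^ 2 * u + d
    * o ^ 2) + t * (n * (-b * t + c * p + d * o) + q * (b * p - d * m + g ^ 2) + f * (f * t - 2 *
    h * p) - g * h * o) + o * (-q * (b * u - d * p + g * j) + h * (2 * f * u + j * o) - c * n * u)
    + c * (m * q * u - p ^ 2 * q) - h ^ 2 * m * u + h ^ 2 * p ^ 2) + j * (o * (c * (2 * f * t - g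
    * r + h * p + j * n) - a * (n * t - o * r + p * q) + b * (-h * t + j * q) - 2 * f * h * j) + r
    * (b * (g * r + h * p - j * n) + a * (-m * r + n * p) - 2 * c * f * p + f ^ 2 * j) - g * (t *
    (b * q + c * n - 2 * f * h) - 2 * c * p * q + 2 * h ^ 2 * p) + m * (-c * (h * t + j * q) + a *
    q * t + h ^ 2 * j)) + g * (t * (-a * (-n * t + o * r + p * q) + c * (-2 * f * t + g * r + h *
    p) + b * h * t) - u * (c * (-2 * f * r + g * q + h * o) + a * (n * r - o * q) + b * h * r - g
    * h ^ 2) + a * p * r ^ 2) - a * (h * (m * (-r * u + t ^ 2) + o * (o * u - 2 * p * t) + p ^ 2 *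
    r)) + c * (c * (m * (-r * u + t ^ 2) + o * (o * u - 2 * p * t) + p ^ 2 * r))

/-- A quintic of weight `(3, 4, 4, 4)`. -/
def quintic3444 {R : Type*} [CommRing R]
    (a b c d e f g h i j k l m n o p q r t u : R) : R :=
  -g * (o * (-h * (3 * e * t + 2 * f * p - 2 * g * o + 2 * i * m + j * l) + c * (l * t + m * r + n
    * p - o ^ 2) + q * (b * p + d * m + e * j - g ^ 2) + i * (2 * e * r - g * n + i * l) + b * (n
    * t - o * r) + f ^ 2 * t - d * l * r) - r * (e * (-f * t + g * r - 2 * h * p + j * n) + k * (c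
    * t - d * r + i ^ 2) + m * (-b * r + d * n + g * h) + f * (f * p - j * l) + b * n * p - g ^ 2
    * n) - q * (m * (b * t + c * p + f * j - g * i) + e * (f * u - g * t + 2 * i * p) + k * (-c *
    u + d * t) - f * g * p) + h * (m * (f * t + h * p + j * n) + u * (e * n + f * l - h * k) + 2 *
    i * k * t - g * n * p) + n * (f * (-g * t + 2 * i * p) - c * l * u + d * l * t) - 2 * f * i *
    l * t) + i * (-m * (h * (-2 * e * t - f * p + i * m + j * l) + r * (-b * o - c * m + d * l + e
    * i) + c * (l * t + o ^ 2) + d * (-m * q + n * o) + f * (f * t - j * n) + b * p * q - i ^ 2 *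
    l) + o * (-e * (2 * f * t + 3 * h * p - 2 * i * o + j * n) + k * (c * t + d * r + h * j - i ^
    2) + b * (l * t + n * p - o ^ 2) + c * l * p + f ^ 2 * p) - k * (f * (h * u - i * t + j * r) +
    p * (c * r + d * q - h * i) - b * q * u + b * r * t) + e * (l * (h * u - i * t + j * r) + e *
    (-q * u + r * t) + f * n * u + f * p * r) - l * (n * (b * u - d * p) + f * i * p)) - e * (r *
    (c * (l * u + m * t - 2 * o * p) + d * (-m * r + n * p + o ^ 2) + e * (-h * u + j * r) + f ^ 2
    * u - 2 * f * j * o) + t * (j * (-e * q + f * n + h * l) - t * (c * l - e * h + f ^ 2) + d *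
    (m * q - n * o) + c * o ^ 2) - p * (-q * (c * p - d * o + f * j) + h ^ 2 * p + h * j * n) - c
    * m * q * u + h ^ 2 * m * u) + b * (r * (f * (l * u + m * t - 2 * o * p) - j * (-k * r + l * o
    + m * n) - h * k * u + h * m * p) + t * (f * (-l * t + o ^ 2) + h * (k * t - 2 * m * o) - j *
    k * q + j * l * n) + h * (n * (m * u - p ^ 2) + o ^ 2 * p) + q * (f * (-m * u + p ^ 2) + j * m
    * o)) - c * (f * (m * (n * u - 2 * o * t + p * r) + k * (-r * u + t ^ 2) - n * p ^ 2 + o ^ 2 *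
    p) + j * (-m * (l * r - m * q + n * o) + k * (o * r - p * q) + l * n * p)) + h * (d * (m * (l
    * t - m * r + o ^ 2) + k * (-o * t + p * r) - l * o * p) + f * (j * (k * t + l * p - 2 * m *
    o) + f * m * u - f * p ^ 2) - h * j * k * p + h * j * m ^ 2)

/-- The Pfaffian `ξ` in general coordinates. -/
def genXi {R : Type*} [CommRing R]
    (a b c d e f g h i j k l m n o p q r t u : R) : R :=
  -o * (-o * (2 * l * t + 2 * m * r + 2 * n * p - o ^ 2) + k * (-q * u + r * t) + l * (n * u + 3 *
    p * r) + 3 * m * n * t + m * p * q) + l * (t * (-l * t + m * r + n * p) + q * (-m * u + p ^ 2)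
    + l * r * u) + n * (k * (-r * u + t ^ 2) + m * (n * u + p * r) - n * p ^ 2) + k * (-p * q * t
    + p * r ^ 2) + m ^ 2 * q * t - m ^ 2 * r ^ 2

/-- The quintic `Gᵃ` in general coordinates. -/
def genGa {R : Type*} [CommRing R]
    (a b c d e f g h i j k l m n o p q r t u : R) : R :=
  -(d * f * u - d * j * o - f * j ^ 2 + g * i * j) * (k * q - l * n)
    - 2 * (e * f * h - f ^ 3) * (o * u - p * t)
    - (e * h * j - 2 * f * g * i) * (m * r + o ^ 2)
    - f ^ 2 * j * (m * r + 3 * o ^ 2)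

/-- The quintic `Gᵇ` in general coordinates. -/
def genGb {R : Type*} [CommRing R]
    (a b c d e f g h i j k l m n o p q r t u : R) : R :=
  -(b * e * n - 2 * b * f * l + b * h * k - e ^ 2 * h + e * f ^ 2) * (r * u - t ^ 2)
    + (b * e * o - 2 * b * g * l + d * e * l - e ^ 2 * i + e * f * g) * (q * u - r * t)
    - (b * e * p - 2 * b * g * m + b * j * k - e ^ 2 * j + e * g ^ 2) * (q * t - r ^ 2)
    + (2 * b * j * p - e * j ^ 2 + g ^ 2 * j) * (l * q - n ^ 2)
    - b * (
    2 * f * (n * o * u - n * p * t - o ^ 2 * t + o * p * r)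
    - 2 * g * (n ^ 2 * u - 2 * n * o * t + o ^ 2 * r)
    - h * (l * o * u - l * p * t - m * o * t + m * p * r)
    - i * (k * q * u - k * r * t - l * n * u + 2 * l * o * t - l * p * r
    - m * n * t + 2 * m * o * r - m * p * q + 2 * n * o * p - 2 * o ^ 3)
    - j * (l * n * t - 3 * l * o * r + m * n * r - m * o * q + 2 * n * o ^ 2)
    )
    - d * (
    e * (n ^ 2 * u - n * o * t - n * p * r + o * p * q) - f * (k * r * t - l * p * r)
    + j * (k * n * r - l ^ 2 * r)
    )
    + (e * i * j - f * g * j) * (l * r + m * q - 2 * n * o)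
    + (3 * e * f * i - e * g * h - 2 * f ^ 2 * g) * n * u
    - (e * f * i + e * g * h - 2 * f ^ 2 * g) * p * r
    - 2 * (e * f * i - e * g * h) * o * t
    + 2 * (2 * e * f * j - e * g * i - f * g ^ 2) * o * r
    - (e * f * j - e * g * i) * p * q
    - (3 * e * f * j - e * g * i - 2 * f * g ^ 2) * n * t
    + (e * h * j + 2 * f ^ 2 * j - 2 * f * g * i) * l * t
    + e * i ^ 2 * o ^ 2
    - e * i ^ 2 * n * p

/-- The quintic `G` in general coordinates. -/
def genG {R : Type*} [CommRing R]
    (a b c d e f g h i j k l m n o p q r t u : R) : R :=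
  -(a * genXi a b c d e f g h i j k l m n o p q r t u) +
    genGa a b c d e f g h i j k l m n o p q r t u +
    genGb a b c d e f g h i j k l m n o p q r t u + genGb a c b d h f i e g j q n r l o t k m p u

/-- The matrix `A₁` in general coordinates. -/
def genA₁ {R : Type*} [CommRing R]
    (a b c d e f g h i j k l m n o p q r t u : R) :
    Matrix (Fin 11) (Fin 11) R :=
  !![0, h, i, g, f, e, c, b, 0, 0, 0;
    -h, 0, 0, t, 0, o, 0, i, n, r, q;
    -i, 0, 0, u, 0, p, 0, j, o, t, r;
    -g, -t, -u, 0, -p, 0, -j, 0, m, p, o;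
    -f, 0, 0, p, 0, m, 0, g, l, o, n;
    -e, -o, -p, 0, -m, 0, -g, 0, k, m, l;
    -c, 0, 0, j, 0, g, 0, d, f, i, h;
    -b, -i, -j, 0, -g, 0, -d, 0, e, g, f;
    0, -n, -o, -m, -l, -k, -f, -e, 0, 0, 0;
    0, -r, -t, -p, -o, -m, -i, -g, 0, 0, 0;
    0, -q, -r, -o, -n, -l, -h, -f, 0, 0, 0]

/-- The matrix `A₂` in general coordinates. -/
def genA₂ {R : Type*} [CommRing R]
    (a b c d e f g h i j k l m n o p q r t u : R) :
    Matrix (Fin 10) (Fin 11) R :=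
  !![d, 0, 0, 0, -j, 0, 0, 0, 0, j, -i;
    -c, 0, 0, 0, i, 0, 0, 0, 0, -i, h;
    b, 0, 0, 0, -g, 0, 0, 0, 0, g, -f;
    a, 0, 0, 0, -d, 0, 0, 0, 0, d, -c;
    0, 0, 0, 0, 0, 0, 0, 0, -d, 0, 0;
    0, 0, 0, 0, 0, 0, 0, 0, c, 0, 0;
    0, 0, 0, 0, 0, 0, 0, 0, -b, 0, 0;
    0, 0, 0, 0, 0, 0, 0, 0, a, 0, 0;
    0, 0, 0, -d, c, -b, 0, -a, 0, -2 * c, 0;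
    0, -c, -d, 0, -2 * b, 0, -a, 0, 0, 2 * b, 0]

/-- The matrix `B₂` in general coordinates. -/
def genB₂ {R : Type*} [CommRing R]
    (a b c d e f g h i j k l m n o p q r t u : R) :
    Matrix (Fin 10) (Fin 10) R :=
  !![j, -t, -p, -u, -m, o, 0, 0, 0, 0;
    -i, r, o, t, l, -n, 0, 0, 0, 0;
    g, -o, -m, -p, -k, l, 0, 0, 0, 0;
    d, -i, -g, -j, -e, f, 0, 0, 0, 0;
    0, 0, 0, 0, g, -i, u, p, -t, j;
    0, 0, 0, 0, -f, h, -t, -o, r, -i;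
    0, 0, 0, 0, e, -f, p, m, -o, g;
    0, 0, 0, 0, -b, c, -j, -g, i, -d;
    -c, h, f, i, 0, 0, -o, -l, n, -f;
    b, -f, -e, -g, 0, 0, m, k, -l, e]

/-- The eleven quintics spanning the kernel of `A₁`. -/
def kernelA₁ {R : Type*} [CommRing R]
    (a b c d e f g h i j k l m n o p q r t u : R) : Fin 11 → R :=
  ![-quintic4245 k e l m b f g n o p a c d h i j q r t u,
    quintic3435 a d c b j i g h f e u t p r o m q n l k,
    quintic3435 a c d b h i f j g e q r n t o l u p m k,
    -quintic3435 a b d c e g f j i h k m l p o n u t r q,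
    quintic3444 a b c d e f g h i j k l m n o p q r t u,
    -quintic3435 a d b c j g i e f h u p t m o r k l n q,
    quintic4245 q h r n c i f t o l a d b j g e u p m k,
    -quintic4245 k e m l b g f p o n a d c j i h u t r q,
    quintic3435 a c b d h f i e g j q n r l o t k m p u,
    quintic3444 a d c b j i g h f e u t p r o m q n l k,
    quintic3435 a b c d e f g h i j k l m n o p q r t u]

/-- The ten quintics solving `B₂ *ᵥ x = A₂ *ᵥ kernelA₁`; the first one is `-G`. -/
def liftB₂ {R : Type*} [CommRing R]
    (a b c d e f g h i j k l m n o p q r t u : R) : Fin 10 → R :=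
  ![-genG a b c d e f g h i j k l m n o p q r t u,
    quintic3444 q h n r c f i l o t a b d e g j k m p u,
    -genG k l e m n f o b g p q h r c i t a d j u -
      quintic3444 k m e l p g o b f n u j t d i r a c h q,
    quintic3444 u j p t d g i m o r a b c e f h k l n q,
    quintic4245 a b c d e f g h i j k l m n o p q r t u,
    -quintic3435 k e l m b f g n o p a c d h i j q r t u,
    -quintic3435 k l m e n o f p g b q r h t i c u j d a,
    -quintic4245 q n r h l o f t i c k m e p g b u j d a,
    quintic3435 k m l e p o g n f b u t j r i d q h c a,
    quintic3444 k m e l p g o b f n u j t d i r a c h q]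

/-! ### Behaviour of the quintics under permutations of the variables 0, 1, 2, 3. -/

/-- The argument list is the action of the transposition (02), which fixes the weight (3, 4, 3, 5).
-/
theorem quintic3435_swap {R : Type*} [CommRing R]
    (a b c d e f g h i j k l m n o p q r t u : R) :
    quintic3435 q n h r l f o c i t k e m b g p a d j u =
      quintic3435 a b c d e f g h i j k l m n o p q r t u := by
  simp only [quintic3435]
  ring

theorem quintic4245_swap {R : Type*} [CommRing R]
    (a b c d e f g h i j k l m n o p q r t u : R) :
    quintic4245 q n h r l f o c i t k e m b g p a d j u =
      quintic4245 a b c d e f g h i j k l m n o p q r t u := by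
  simp only [quintic4245]
  ring

theorem quintic3444_swap {R : Type*} [CommRing R]
    (a b c d e f g h i j k l m n o p q r t u : R) :
    quintic3444 a c b d h f i e g j q n r l o t k m p u =
      -quintic3444 a b c d e f g h i j k l m n o p q r t u := by
  simp only [quintic3444]
  ring

/-- With f = `quintic3444`, this reads (23)f = f - (13)f. Together with (12)f = -f it says that f
transforms like e₁ - e₂ in the standard representation of the permutations of 1, 2, 3, so the
translates of f under these permutations reduce to two. -/
theorem quintic3444_cycle {R : Type*} [CommRing R]
    (a b c d e f g h i j k l m n o p q r t u : R) :
    quintic3444 a b d c e g f j i h k m l p o n u t r q =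
      quintic3444 a b c d e f g h i j k l m n o p q r t u -
      quintic3444 a d c b j i g h f e u t p r o m q n l k := by
  simp only [quintic3444]
  ring

theorem genG_swap {R : Type*} [CommRing R]
    (a b c d e f g h i j k l m n o p q r t u : R) :
    genG a c b d h f i e g j q n r l o t k m p u = genG a b c d e f g h i j k l m n o p q r t u := by
  simp only [genG, genXi, genGa, genGb]
  ring

/-- G is fixed by (12), but by (23) only up to a translate of `quintic3444`. These correction terms
appear whenever a row of the lift is moved by a permutation. -/
theorem genG_swap_last {R : Type*} [CommRing R]
    (a b c d e f g h i j k l m n o p q r t u : R) :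
    genG a b d c e g f j i h k m l p o n u t r q = genG a b c d e f g h i j k l m n o p q r t u +
      2 * quintic3444 a d c b j i g h f e u t p r o m q n l k := by
  simp only [quintic3444, genG, genXi, genGa, genGb]
  ring

/-! ### The kernel vector of `A₁` and its lift through `B₂`. -/

set_option maxRecDepth 10000 in
-- One row of A₁x = 0, named by its weight. This row and the next two represent the row weights of
-- `A₁` up to permutation of the variables.
theorem kernel_row_4554 {R : Type*} [CommRing R]
    (a b c d e f g h i j k l m n o p q r t u : R) :
    i * quintic3435 a c d b h i f j g e q r n t o l u p m k + h *
      quintic3435 a d c b j i g h f e u t p r o m q n l k - g *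
      quintic3435 a b d c e g f j i h k m l p o n u t r q + f *
      quintic3444 a b c d e f g h i j k l m n o p q r t u - e *
      quintic3435 a d b c j g i e f h u p t m o r k l n q + c *
      quintic4245 q h r n c i f t o l a d b j g e u p m k - b *
      quintic4245 k e m l b g f p o n a d c j i h u t r q = 0 := by
  simp only [quintic3435, quintic4245, quintic3444]
  ring

set_option maxRecDepth 10000 in
theorem kernel_row_3465 {R : Type*} [CommRing R]
    (a b c d e f g h i j k l m n o p q r t u : R) :
    -t * quintic3435 a b d c e g f j i h k m l p o n u t r q + r *
      quintic3444 a d c b j i g h f e u t p r o m q n l k + q *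
      quintic3435 a b c d e f g h i j k l m n o p q r t u - o *
      quintic3435 a d b c j g i e f h u p t m o r k l n q + n *
      quintic3435 a c b d h f i e g j q n r l o t k m p u - i *
      quintic4245 k e m l b g f p o n a d c j i h u t r q + h *
      quintic4245 k e l m b f g n o p a c d h i j q r t u = 0 := by
  simp only [quintic3435, quintic4245, quintic3444]
  ring

set_option maxRecDepth 10000 in
theorem kernel_row_3555 {R : Type*} [CommRing R]
    (a b c d e f g h i j k l m n o p q r t u : R) :
    -p * quintic3435 a b d c e g f j i h k m l p o n u t r q + o *
      quintic3444 a d c b j i g h f e u t p r o m q n l k + n *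
      quintic3435 a b c d e f g h i j k l m n o p q r t u - m *
      quintic3435 a d b c j g i e f h u p t m o r k l n q + l *
      quintic3435 a c b d h f i e g j q n r l o t k m p u - g *
      quintic4245 k e m l b g f p o n a d c j i h u t r q + f *
      quintic4245 k e l m b f g n o p a c d h i j q r t u = 0 := by
  simp only [quintic3435, quintic4245, quintic3444]
  ring

set_option maxRecDepth 10000 in
-- A row of B₂y = A₂x that is expanded directly; the other such row is that of weight 5454.
theorem lift_row_4446 {R : Type*} [CommRing R]
    (a b c d e f g h i j k l m n o p q r t u : R) :
    -u * quintic3444 u j p t d g i m o r a b c e f h k l n q - t *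
      quintic3444 q h n r c f i l o t a b d e g j k m p u + p *
      genG k l e m n f o b g p q h r c i t a d j u + p *
      quintic3444 k m e l p g o b f n u j t d i r a c h q - o *
      quintic3435 k e l m b f g n o p a c d h i j q r t u - m *
      quintic4245 a b c d e f g h i j k l m n o p q r t u - j *
      genG a b c d e f g h i j k l m n o p q r t u + j *
      quintic3444 a b c d e f g h i j k l m n o p q r t u - j *
      quintic3444 a d c b j i g h f e u t p r o m q n l k + i *
      quintic3435 a b c d e f g h i j k l m n o p q r t u + d *
      quintic4245 k e l m b f g n o p a c d h i j q r t u = 0 := by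
  simp only [quintic3435, quintic4245, quintic3444, genG, genXi, genGa, genGb]
  ring

set_option maxRecDepth 10000 in
theorem lift_row_5454 {R : Type*} [CommRing R]
    (a b c d e f g h i j k l m n o p q r t u : R) :
    o * quintic3435 k l m e n o f p g b q r h t i c u j d a + n *
      quintic3435 k m l e p o g n f b u t j r i d q h c a + l *
      quintic4245 q n r h l o f t i c k m e p g b u j d a + i *
      quintic3444 u j p t d g i m o r a b c e f h k l n q + h *
      quintic3444 q h n r c f i l o t a b d e g j k m p u - f *
      genG k l e m n f o b g p q h r c i t a d j u - 2 * f *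
      quintic3444 k m e l p g o b f n u j t d i r a c h q - d *
      quintic3435 a b d c e g f j i h k m l p o n u t r q + c *
      genG a b c d e f g h i j k l m n o p q r t u - c *
      quintic3444 a b c d e f g h i j k l m n o p q r t u + 2 * c *
      quintic3444 a d c b j i g h f e u t p r o m q n l k - b *
      quintic3435 a d b c j g i e f h u p t m o r k l n q - a *
      quintic4245 k e m l b g f p o n a d c j i h u t r q = 0 := by
  simp only [quintic3435, quintic4245, quintic3444, genG, genXi, genGa, genGb]
  ring

/-- Each row is an expanded row or comes from translates of one. The remaining terms of each
combination rewrite translated quintics as the chosen entries of the kernel vector. -/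
theorem genA₁_mulVec_kernelA₁ {R : Type*} [CommRing R]
    (a b c d e f g h i j k l m n o p q r t u : R) :
    genA₁ a b c d e f g h i j k l m n o p q r t u *ᵥ
      kernelA₁ a b c d e f g h i j k l m n o p q r t u = 0 := by
  ext i
  fin_cases i <;>
    simp [genA₁, kernelA₁, mulVec, dotProduct, Fin.sum_univ_succ]
  · linear_combination
      kernel_row_4554 a b c d e f g h i j k l m n o p q r t u
  · linear_combination
      kernel_row_3465 a b c d e f g h i j k l m n o p q r t u
  · linear_combination
      -kernel_row_3465 a b d c e g f j i h k m l p o n u t r q + t *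
        quintic3444_swap a c d b h i f j g e q r n t o l u p m k
  · linear_combination
      -kernel_row_3465 a c d b h i f j g e q r n t o l u p m k + p *
        quintic3444_cycle a b c d e f g h i j k l m n o p q r t u - g *
        quintic4245_swap k e l m b f g n o p a c d h i j q r t u
  · linear_combination
      kernel_row_3555 a b c d e f g h i j k l m n o p q r t u
  · linear_combination
      kernel_row_3465 a c b d h f i e g j q n r l o t k m p u - m *
        quintic3444_cycle a d c b j i g h f e u t p r o m q n l k - e *
        quintic4245_swap k e l m b f g n o p a c d h i j q r t u
  · linear_combination
      -kernel_row_4554 a c d b h i f j g e q r n t o l u p m k + i *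
        quintic3444_swap a c d b h i f j g e q r n t o l u p m k + d *
        quintic4245_swap k e m l b g f p o n a d c j i h u t r q - c *
        quintic4245_swap k e l m b f g n o p a c d h i j q r t u
  · linear_combination
      -kernel_row_4554 a b d c e g f j i h k m l p o n u t r q + g *
        quintic3444_cycle a b c d e f g h i j k l m n o p q r t u + d *
        quintic4245_swap q h r n c i f t o l a d b j g e u p m k
  · linear_combination
      kernel_row_3465 a d b c j g i e f h u p t m o r k l n q - l *
        quintic3444_swap a b c d e f g h i j k l m n o p q r t u + f *
        quintic4245_swap q h r n c i f t o l a d b j g e u p m k - e *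
        quintic4245_swap k e m l b g f p o n a d c j i h u t r q
  -- The second row of weight 3555 is the (12)-translate of the first one minus the first one.
  · linear_combination
      -kernel_row_3555 a b c d e f g h i j k l m n o p q r t u +
        kernel_row_3555 a c b d h f i e g j q n r l o t k m p u - o *
        quintic3444_cycle a d c b j i g h f e u t p r o m q n l k - f *
        quintic4245_swap k e l m b f g n o p a c d h i j q r t u
  · linear_combination
      -kernel_row_3465 a d c b j i g h f e u t p r o m q n l k + h *
        quintic4245_swap q h r n c i f t o l a d b j g e u p m k - f *
        quintic4245_swap k e m l b g f p o n a d c j i h u t r q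

/-- The rows of weight 5346, 5355, 5445 (the second one) and 6345 are permuted weights of rows of
`A₁`, and follow from the kernel relations alone. The rows other than these and the two expanded
ones combine kernel relations with translates of the row 5454. -/
theorem genB₂_mulVec_liftB₂ {R : Type*} [CommRing R]
    (a b c d e f g h i j k l m n o p q r t u : R) :
    genB₂ a b c d e f g h i j k l m n o p q r t u *ᵥ
      liftB₂ a b c d e f g h i j k l m n o p q r t u =
    genA₂ a b c d e f g h i j k l m n o p q r t u *ᵥ
      kernelA₁ a b c d e f g h i j k l m n o p q r t u := by
  ext i
  fin_cases i <;>
    simp [genB₂, liftB₂, genA₂, kernelA₁, mulVec, dotProduct, Fin.sum_univ_succ]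
  · linear_combination
      lift_row_4446 a b c d e f g h i j k l m n o p q r t u
  · linear_combination
      kernel_row_4554 a c d b h i f j g e q r n t o l u p m k -
        kernel_row_4554 k l m e n o f p g b q r h t i c u j d a -
        lift_row_5454 q h r n c i f t o l a d b j g e u p m k +
        lift_row_5454 q n r h l o f t i c k m e p g b u j d a + t *
        quintic3444_cycle u t p j r o i m g d q n h l f c k e b a + r *
        quintic3444_cycle q h r n c i f t o l a d b j g e u p m k - r *
        genG_swap_last q h r n c i f t o l a d b j g e u p m k + r *
        genG_swap_last q n r h l o f t i c k m e p g b u j d a - r *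
        genG_swap q h n r c f i l o t a b d e g j k m p u + q *
        quintic4245_swap a c b d h f i e g j q n r l o t k m p u + 2 * o *
        quintic3444_swap k e l m b f g n o p a c d h i j q r t u + o *
        quintic3444_cycle k l e m n f o b g p q h r c i t a d j u + o *
        genG_swap k l m e n o f p g b q r h t i c u j d a + o *
        genG_swap_last k l e m n f o b g p q h r c i t a d j u - l *
        quintic4245_swap a b c d e f g h i j k l m n o p q r t u - 3 * i *
        quintic3444_swap a b c d e f g h i j k l m n o p q r t u - i *
        quintic3444_swap a c d b h i f j g e q r n t o l u p m k - i *
        genG_swap_last a b c d e f g h i j k l m n o p q r t u - i *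
        genG_swap_last a d b c j g i e f h u p t m o r k l n q - i *
        genG_swap a b d c e g f j i h k m l p o n u t r q - f *
        quintic3435_swap a c b d h f i e g j q n r l o t k m p u + c *
        quintic4245_swap k e l m b f g n o p a c d h i j q r t u
  · linear_combination
      -kernel_row_4554 a b d c e g f j i h k m l p o n u t r q +
        lift_row_5454 k e m l b g f p o n a d c j i h u t r q - p *
        quintic3444_swap u j p t d g i m o r a b c e f h k l n q - o *
        quintic3444_swap q h n r c f i l o t a b d e g j k m p u + m *
        quintic3444_swap k e m l b g f p o n a d c j i h u t r q + m *
        genG_swap k e l m b f g n o p a c d h i j q r t u + m *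
        genG_swap_last k e m l b g f p o n a d c j i h u t r q + 2 * g *
        quintic3444_swap a b c d e f g h i j k l m n o p q r t u + g *
        quintic3444_cycle a b c d e f g h i j k l m n o p q r t u + g *
        genG_swap a b d c e g f j i h k m l p o n u t r q + g *
        genG_swap_last a b c d e f g h i j k l m n o p q r t u + e *
        quintic3435_swap a c b d h f i e g j q n r l o t k m p u
  · linear_combination
      kernel_row_4554 k e m l b g f p o n a d c j i h u t r q -
        lift_row_5454 a b d c e g f j i h k m l p o n u t r q - g *
        quintic3444_swap k e m l b g f p o n a d c j i h u t r q - g *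
        genG_swap_last k l e m n f o b g p q h r c i t a d j u + g *
        genG_swap_last k m e l p g o b f n u j t d i r a c h q - g *
        genG_swap k l m e n o f p g b q r h t i c u j d a + 2 * d *
        quintic3444_swap a c d b h i f j g e q r n t o l u p m k - d *
        quintic3444_cycle a b c d e f g h i j k l m n o p q r t u + d *
        genG_swap_last a b c d e f g h i j k l m n o p q r t u + b *
        quintic3435_swap a c b d h f i e g j q n r l o t k m p u
  · linear_combination
      -kernel_row_3465 k l m e n o f p g b q r h t i c u j d a + j *
        quintic3444_swap k e m l b g f p o n a d c j i h u t r q - g *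
        quintic4245_swap a b c d e f g h i j k l m n o p q r t u - d *
        quintic3435_swap a c b d h f i e g j q n r l o t k m p u
  · linear_combination
      -kernel_row_3555 k l e m n f o b g p q h r c i t a d j u + f *
        quintic4245_swap a b c d e f g h i j k l m n o p q r t u + c *
        quintic3435_swap a c b d h f i e g j q n r l o t k m p u
  · linear_combination
      -kernel_row_4554 k e m l b g f p o n a d c j i h u t r q + m *
        quintic4245_swap q n r h l o f t i c k m e p g b u j d a + g *
        quintic3444_swap k e m l b g f p o n a d c j i h u t r q - b *
        quintic3435_swap a c b d h f i e g j q n r l o t k m p u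
  · linear_combination
      -kernel_row_3465 k l e m n f o b g p q h r c i t a d j u + b *
        quintic4245_swap a b c d e f g h i j k l m n o p q r t u + a *
        quintic3435_swap a c b d h f i e g j q n r l o t k m p u
  · linear_combination
      lift_row_5454 a b c d e f g h i j k l m n o p q r t u
  · linear_combination
      kernel_row_4554 q h n r c f i l o t a b d e g j k m p u -
        lift_row_5454 a c b d h f i e g j q n r l o t k m p u +
        lift_row_5454 k l e m n f o b g p q h r c i t a d j u - g *
        quintic3444_cycle u j t p d i g r o m a c b h f e q n l k - 2 * f *
        quintic3444_cycle q r n h t o i l f c u p j m g d k e b a - f *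
        genG_swap q h n r c f i l o t a b d e g j k m p u + e *
        quintic3444_swap k e l m b f g n o p a c d h i j q r t u + b *
        quintic3444_swap a b c d e f g h i j k l m n o p q r t u - 2 * b *
        quintic3444_cycle a d b c j g i e f h u p t m o r k l n q + b *
        genG_swap a b c d e f g h i j k l m n o p q r t u

/-! ### Explicit Pfaffians. -/

theorem pf_one {R : Type*} [CommRing R] (M : Matrix (Fin 2) (Fin 2) R) : pf 1 M = M 0 1 := by
  simp [pf]

theorem pf_two {R : Type*} [CommRing R] (M : Matrix (Fin 4) (Fin 4) R) :
    pf 2 M =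
    M 0 1 * M 2 3 - M 0 2 * M 1 3 + M 0 3 * M 1 2 := by
  rw [pf]
  simp only [Fin.sum_univ_succ, pf_one, submatrix_apply, Fin.sum_univ_zero, add_zero]
  simp [Fin.succAbove, Fin.lt_def]
  ring

theorem pf_three {R : Type*} [CommRing R] (M : Matrix (Fin 6) (Fin 6) R) :
    pf 3 M =
    M 0 1 * (M 2 3 * M 4 5 - M 2 4 * M 3 5 + M 2 5 * M 3 4) - M 0 2 * (M 1 3 * M 4 5 - M 1 4 * M 3
      5 + M 1 5 * M 3 4) + M 0 3 * (M 1 2 * M 4 5 - M 1 4 * M 2 5 + M 1 5 * M 2 4) - M 0 4 * (M 1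
      2 * M 3 5 - M 1 3 * M 2 5 + M 1 5 * M 2 3) + M 0 5 * (M 1 2 * M 3 4 - M 1 3 * M 2 4 + M 1 4
      * M 2 3) := by
  rw [pf]
  simp only [Fin.sum_univ_succ, pf_two, submatrix_apply, Fin.sum_univ_zero, add_zero]
  simp [Fin.succAbove, Fin.lt_def]
  ring

theorem pf_four {R : Type*} [CommRing R] (M : Matrix (Fin 8) (Fin 8) R) :
    pf 4 M =
    M 0 1 * (M 2 3 * (M 4 5 * M 6 7 - M 4 6 * M 5 7 + M 4 7 * M 5 6) - M 2 4 * (M 3 5 * M 6 7 - M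
      3 6 * M 5 7 + M 3 7 * M 5 6) + M 2 5 * (M 3 4 * M 6 7 - M 3 6 * M 4 7 + M 3 7 * M 4 6) - M 2
      6 * (M 3 4 * M 5 7 - M 3 5 * M 4 7 + M 3 7 * M 4 5) + M 2 7 * (M 3 4 * M 5 6 - M 3 5 * M 4 6
      + M 3 6 * M 4 5)) - M 0 2 * (M 1 3 * (M 4 5 * M 6 7 - M 4 6 * M 5 7 + M 4 7 * M 5 6) - M 1 4
      * (M 3 5 * M 6 7 - M 3 6 * M 5 7 + M 3 7 * M 5 6) + M 1 5 * (M 3 4 * M 6 7 - M 3 6 * M 4 7 +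
      M 3 7 * M 4 6) - M 1 6 * (M 3 4 * M 5 7 - M 3 5 * M 4 7 + M 3 7 * M 4 5) + M 1 7 * (M 3 4 *
      M 5 6 - M 3 5 * M 4 6 + M 3 6 * M 4 5)) + M 0 3 * (M 1 2 * (M 4 5 * M 6 7 - M 4 6 * M 5 7 +
      M 4 7 * M 5 6) - M 1 4 * (M 2 5 * M 6 7 - M 2 6 * M 5 7 + M 2 7 * M 5 6) + M 1 5 * (M 2 4 *
      M 6 7 - M 2 6 * M 4 7 + M 2 7 * M 4 6) - M 1 6 * (M 2 4 * M 5 7 - M 2 5 * M 4 7 + M 2 7 * M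
      4 5) + M 1 7 * (M 2 4 * M 5 6 - M 2 5 * M 4 6 + M 2 6 * M 4 5)) - M 0 4 * (M 1 2 * (M 3 5 *
      M 6 7 - M 3 6 * M 5 7 + M 3 7 * M 5 6) - M 1 3 * (M 2 5 * M 6 7 - M 2 6 * M 5 7 + M 2 7 * M
      5 6) + M 1 5 * (M 2 3 * M 6 7 - M 2 6 * M 3 7 + M 2 7 * M 3 6) - M 1 6 * (M 2 3 * M 5 7 - M
      2 5 * M 3 7 + M 2 7 * M 3 5) + M 1 7 * (M 2 3 * M 5 6 - M 2 5 * M 3 6 + M 2 6 * M 3 5)) + M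
      0 5 * (M 1 2 * (M 3 4 * M 6 7 - M 3 6 * M 4 7 + M 3 7 * M 4 6) - M 1 3 * (M 2 4 * M 6 7 - M
      2 6 * M 4 7 + M 2 7 * M 4 6) + M 1 4 * (M 2 3 * M 6 7 - M 2 6 * M 3 7 + M 2 7 * M 3 6) - M 1
      6 * (M 2 3 * M 4 7 - M 2 4 * M 3 7 + M 2 7 * M 3 4) + M 1 7 * (M 2 3 * M 4 6 - M 2 4 * M 3 6
      + M 2 6 * M 3 4)) - M 0 6 * (M 1 2 * (M 3 4 * M 5 7 - M 3 5 * M 4 7 + M 3 7 * M 4 5) - M 1 3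
      * (M 2 4 * M 5 7 - M 2 5 * M 4 7 + M 2 7 * M 4 5) + M 1 4 * (M 2 3 * M 5 7 - M 2 5 * M 3 7 +
      M 2 7 * M 3 5) - M 1 5 * (M 2 3 * M 4 7 - M 2 4 * M 3 7 + M 2 7 * M 3 4) + M 1 7 * (M 2 3 *
      M 4 5 - M 2 4 * M 3 5 + M 2 5 * M 3 4)) + M 0 7 * (M 1 2 * (M 3 4 * M 5 6 - M 3 5 * M 4 6 +
      M 3 6 * M 4 5) - M 1 3 * (M 2 4 * M 5 6 - M 2 5 * M 4 6 + M 2 6 * M 4 5) + M 1 4 * (M 2 3 *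
      M 5 6 - M 2 5 * M 3 6 + M 2 6 * M 3 5) - M 1 5 * (M 2 3 * M 4 6 - M 2 4 * M 3 6 + M 2 6 * M
      3 4) + M 1 6 * (M 2 3 * M 4 5 - M 2 4 * M 3 5 + M 2 5 * M 3 4)) := by
  rw [pf]
  simp only [Fin.sum_univ_succ, pf_three, submatrix_apply, Fin.sum_univ_zero, add_zero]
  simp [Fin.succAbove, Fin.lt_def]
  ring

/-- Identifies the last entry of the kernel vector with Pf(Ã₁), including the sign. -/
theorem pf_genA₁ {R : Type*} [CommRing R] (a b c d e f g h i j k l m n o p q r t u : R) :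
    pf 5 ((genA₁ a b c d e f g h i j k l m n o p q r t u).submatrix Fin.castSucc Fin.castSucc) =
      quintic3435 a b c d e f g h i j k l m n o p q r t u := by
  rw [pf]
  simp only [Fin.sum_univ_succ, pf_four, submatrix_apply, Fin.sum_univ_zero, add_zero]
  simp [genA₁, Fin.succAbove, Fin.lt_def]
  simp only [quintic3435]
  ring

theorem pf_genA₁_submatrix {R : Type*} [CommRing R]
    (a b c d e f g h i j k l m n o p q r t u : R) :
    pf 4 ((genA₁ a b c d e f g h i j k l m n o p q r t u).submatrix
      ![1, 2, 3, 4, 5, 8, 9, 10] ![1, 2, 3, 4, 5, 8, 9, 10]) =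
      genXi a b c d e f g h i j k l m n o p q r t u := by
  simp only [pf_four, submatrix_apply]
  simp [genA₁, genXi]
  ring

/-! ### Determinants of Ã₁ and `B₂` by Schur complements. -/

/-- If `A * H = δ • B`, then `H` reduces `fromBlocks A B C D` to a Schur complement scaled
by `δ`. -/
theorem det_fromBlocks_mul_pow_card {R m n : Type*} [CommRing R] [Fintype m] [Fintype n]
    [DecidableEq m] [DecidableEq n] (A : Matrix m m R) (B : Matrix m n R) (C : Matrix n m R)
    (D : Matrix n n R) (H : Matrix m n R) (δ : R) (h : A * H = δ • B) :
    (fromBlocks A B C D).det * δ ^ Fintype.card n = A.det * (δ • D - C * H).det := by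
  have key : fromBlocks A B C D * fromBlocks 1 (-H) 0 (δ • (1 : Matrix n n R)) =
      fromBlocks A 0 C (δ • D - C * H) := by
    rw [fromBlocks_multiply]
    congr 1 <;> simp [h]
    rw [sub_eq_neg_add]
  have := congrArg det key
  rwa [det_mul, det_fromBlocks_zero₂₁, det_fromBlocks_zero₁₂, det_one, one_mul, det_smul,
    det_one, mul_one] at this

/-- One block row and one block column operation make the matrix block triangular with -Q twice on
the diagonal, so the signs cancel for every size. -/
theorem det_fromBlocks_zero_neg {R n : Type*} [CommRing R] [Fintype n] [DecidableEq n]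
    (Q : Matrix n n R) : (fromBlocks 0 Q (-Q) 0).det = Q.det ^ 2 := by
  have key : fromBlocks 1 1 0 1 * fromBlocks 0 Q (-Q) 0 * fromBlocks 1 1 0 1 =
      fromBlocks (-Q) 0 (-Q) (-Q) := by
    simp [fromBlocks_multiply]
  have := congrArg det key
  rw [det_mul, det_mul, det_fromBlocks_zero₂₁, det_fromBlocks_zero₁₂, det_one, one_mul, one_mul,
    mul_one, det_neg] at this
  rw [this, mul_mul_mul_comm, ← pow_add, Even.neg_one_pow ⟨_, rfl⟩, one_mul, sq]

/-- The catalecticant of the partial derivative in the direction of the last variable, with the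
variables in reversed order. -/
def cat {R : Type*} (d g i j m o p r t u : R) : Matrix (Fin 4) (Fin 4) R :=
  !![u, t, p, j; t, r, o, i; p, o, m, g; j, i, g, d]

/-- The determinant of `cat`. -/
def catDet {R : Type*} [CommRing R] (d g i j m o p r t u : R) : R :=
    u * (r * (m * d - g * g) - o * (o * d - g * i) + i * (o * g - m * i)) + t * (-(t * (m * d - g
      * g) - o * (p * d - g * j) + i * (p * g - m * j))) + p * (t * (o * d - g * i) - r * (p * d -
      g * j) + i * (p * i - o * j)) + j * (-(t * (o * g - m * i) - r * (p * g - m * j) + o * (p *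
      i - o * j)))

/-- The adjugate of `cat`. -/
def catAdj {R : Type*} [CommRing R] (d g i j m o p r t u : R) : Matrix (Fin 4) (Fin 4) R :=
  !![r * (m * d - g * g) - o * (o * d - g * i) + i * (o * g - m * i),
      -(t * (m * d - g * g) - o * (p * d - g * j) + i * (p * g - m * j)),
      t * (o * d - g * i) - r * (p * d - g * j) + i * (p * i - o * j),
      -(t * (o * g - m * i) - r * (p * g - m * j) + o * (p * i - o * j));
    -(t * (m * d - g * g) - o * (p * d - g * j) + i * (p * g - m * j)),
      u * (m * d - g * g) - p * (p * d - g * j) + j * (p * g - m * j),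
      -(u * (o * d - g * i) - t * (p * d - g * j) + j * (p * i - o * j)),
      u * (o * g - m * i) - t * (p * g - m * j) + p * (p * i - o * j);
    t * (o * d - g * i) - r * (p * d - g * j) + i * (p * i - o * j),
      -(u * (o * d - g * i) - t * (p * d - g * j) + j * (p * i - o * j)),
      u * (r * d - i * i) - t * (t * d - i * j) + j * (t * i - r * j),
      -(u * (r * g - o * i) - t * (t * g - o * j) + p * (t * i - r * j));
    -(t * (o * g - m * i) - r * (p * g - m * j) + o * (p * i - o * j)),
      u * (o * g - m * i) - t * (p * g - m * j) + p * (p * i - o * j),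
      -(u * (r * g - o * i) - t * (t * g - o * j) + p * (t * i - r * j)),
      u * (r * m - o * o) - t * (t * m - o * p) + p * (t * o - r * p)]

theorem cat_mul_catAdj {R : Type*} [CommRing R] (d g i j m o p r t u : R) :
    cat d g i j m o p r t u * catAdj d g i j m o p r t u =
      catDet d g i j m o p r t u • (1 : Matrix (Fin 4) (Fin 4) R) := by
  ext x y
  fin_cases x <;> fin_cases y <;>
    simp [cat, catAdj, catDet, mul_apply, Fin.sum_univ_succ] <;> ring

theorem det_cat {R : Type*} [CommRing R] (d g i j m o p r t u : R) :
    (cat d g i j m o p r t u).det = catDet d g i j m o p r t u := by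
  simp [cat, catDet, det_succ_row_zero, Fin.sum_univ_succ, Fin.succAbove]
  ring

/-- A splitting of the row and column positions of `A₁` into two quadruples and a pair. -/
def pos₁ : (Fin 4 ⊕ Fin 4) ⊕ Fin 2 → Fin 10 :=
  Sum.elim (Sum.elim ![2, 1, 4, 6] ![3, 9, 5, 7]) ![8, 0]

set_option maxHeartbeats 1000000 in
-- The two isotropic quadruples of positions pair through Q, so the Schur complement is a skew 2 × 2
-- matrix with the quintic off the diagonal. Nonvanishing of det(Q) is needed only to cancel its
-- square.
theorem det_genA₁ {R : Type*} [CommRing R] [IsDomain R]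
    (a b c d e f g h i j k l m n o p q r t u : R)
    (h0 : catDet d g i j m o p r t u ≠ 0) :
    ((genA₁ a b c d e f g h i j k l m n o p q r t u).submatrix Fin.castSucc Fin.castSucc).det =
      quintic3435 a b c d e f g h i j k l m n o p q r t u ^ 2 := by
  set M := (genA₁ a b c d e f g h i j k l m n o p q r t u).submatrix
    (Fin.castSucc (n := 10)) (Fin.castSucc (n := 10)) with hM
  -- Adding row 4 to row 9, and likewise for columns, clears the entries of row and column 9 at
  -- positions 3, 5, 7 and keeps the matrix skew; the quadruple 3, 9, 5, 7 becomes isotropic.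
  set M₁ := M.updateRow 9 (M 9 + M 4) with hM₁
  set M₂ := M₁.updateCol 9 (fun x => M₁ x 9 + M₁ x 4) with hM₂
  have hdet : M₂.det = M.det := by
    rw [hM₂, det_updateCol_add_self _ (by decide), hM₁, det_updateRow_add_self _ (by decide)]
  set δ := catDet d g i j m o p r t u
  set Q := cat d g i j m o p r t u with hQ
  set J := catAdj d g i j m o p r t u with hJ
  set Y : Matrix (Fin 4) (Fin 2) R := !![o, -i; n, -h; l, -f; f, -c]
  set Z : Matrix (Fin 4) (Fin 2) R := !![m, -g; l, -f; k, -e; e, -b]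
  have hblocks : M₂.submatrix (Equiv.ofBijective pos₁ (by decide))
      (Equiv.ofBijective pos₁ (by decide)) =
      fromBlocks (fromBlocks 0 Q (-Q) 0) (fromRows Y Z) (-(fromRows Y Z)ᵀ) 0 := by
    ext x y
    rcases x with (x | x) | x <;> rcases y with (y | y) | y <;> fin_cases x <;> fin_cases y <;>
      first
      | rfl
      | simp [pos₁, M₂, M₁, M, Q, Y, Z, cat, updateRow_apply, genA₁, Fin.castSucc]
  have hmul : fromBlocks 0 Q (-Q) 0 * fromRows (-(J * Z)) (J * Y) = δ • fromRows Y Z := by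
    have h := cat_mul_catAdj d g i j m o p r t u
    rw [fromBlocks_mul_fromRows]
    simp [← Matrix.mul_assoc, hQ, hJ, h, δ]
    ext (x | x) y <;> simp
  have hskew : (fromRows Y Z)ᵀ * fromRows (-(J * Z)) (J * Y) =
      !![0, quintic3435 a b c d e f g h i j k l m n o p q r t u;
        -quintic3435 a b c d e f g h i j k l m n o p q r t u, 0] := by
    rw [transpose_fromRows, fromCols_mul_fromRows]
    ext x y
    fin_cases x <;> fin_cases y <;>
      simp [Y, Z, J, catAdj, mul_apply, Fin.sum_univ_succ] <;>
      (try simp only [quintic3435]) <;> ring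
  have hschur := det_fromBlocks_mul_pow_card (fromBlocks 0 Q (-Q) 0) (fromRows Y Z)
    (-(fromRows Y Z)ᵀ) 0 _ δ hmul
  rw [← hblocks, det_submatrix_equiv_self, hdet, det_fromBlocks_zero_neg, hQ, det_cat,
    Matrix.neg_mul, hskew, Fintype.card_fin] at hschur
  -- δ² occurs on both sides: on the left from scaling the two border columns, on the right as the
  -- determinant of the block with Q and -Q.
  refine mul_right_cancel₀ (pow_ne_zero 2 h0) (hschur.trans ?_)
  simp [det_fin_two]
  ring

/-- A splitting of the row positions of `B₂` into two quadruples and a pair. -/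
def rowPos₂ : (Fin 4 ⊕ Fin 4) ⊕ Fin 2 → Fin 10 :=
  Sum.elim (Sum.elim ![0, 1, 2, 3] ![4, 5, 6, 7]) ![8, 9]

set_option maxHeartbeats 1000000 in
-- The first four rows and the next four each contain Q up to row and column signs, in disjoint sets
-- of columns; columns 4 and 5 form the border.
theorem det_genB₂ {R : Type*} [CommRing R] [IsDomain R]
    (a b c d e f g h i j k l m n o p q r t u : R)
    (h0 : catDet d g i j m o p r t u ≠ 0) :
    (genB₂ a b c d e f g h i j k l m n o p q r t u).det =
      quintic3435 a b c d e f g h i j k l m n o p q r t u ^ 2 := by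
  set M := genB₂ a b c d e f g h i j k l m n o p q r t u with hM
  set σ : Equiv.Perm (Fin 10) :=
    Equiv.ofBijective ![3, 1, 2, 0, 6, 8, 7, 9, 4, 5] (by decide) with hσ
  have hsign : Equiv.Perm.sign σ = 1 := by rw [hσ]; decide
  set δ := catDet d g i j m o p r t u
  set Q := cat d g i j m o p r t u with hQ
  set J := catAdj d g i j m o p r t u with hJ
  -- These diagonal sign matrices turn the two 4 × 4 blocks into D₁QD₂ and D₃QD₁. Being involutions,
  -- they let the adjugate of Q serve for both blocks.
  set D₁ : Matrix (Fin 4) (Fin 4) R := diagonal ![1, -1, 1, 1] with hD₁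
  set D₂ : Matrix (Fin 4) (Fin 4) R := diagonal ![-1, -1, -1, 1] with hD₂
  set D₃ : Matrix (Fin 4) (Fin 4) R := diagonal ![1, -1, 1, -1] with hD₃
  have hD₁D₁ : D₁ * D₁ = 1 := by
    rw [hD₁, diagonal_mul_diagonal, ← diagonal_one]
    congr 1
    ext x
    fin_cases x <;> simp
  have hD₂D₂ : D₂ * D₂ = 1 := by
    rw [hD₂, diagonal_mul_diagonal, ← diagonal_one]
    congr 1
    ext x
    fin_cases x <;> simp
  have hD₃D₃ : D₃ * D₃ = 1 := by
    rw [hD₃, diagonal_mul_diagonal, ← diagonal_one]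
    congr 1
    ext x
    fin_cases x <;> simp
  set Y : Matrix (Fin 4) (Fin 2) R := !![-m, o; l, -n; -k, l; -e, f]
  set Z : Matrix (Fin 4) (Fin 2) R := !![g, -i; -f, h; e, -f; -b, c]
  set U : Matrix (Fin 2) (Fin 4) R := !![i, h, f, -c; -g, -f, -e, b]
  set W : Matrix (Fin 2) (Fin 4) R := !![-o, n, -l, -f; m, -l, k, e]
  have hblocks : (M.submatrix id σ).submatrix (Equiv.ofBijective rowPos₂ (by decide))
      (Equiv.ofBijective rowPos₂ (by decide)) =
      fromBlocks (fromBlocks (D₁ * Q * D₂) 0 0 (D₃ * Q * D₁)) (fromRows Y Z) (fromCols U W) 0 := by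
    ext x y
    rcases x with (x | x) | x <;> rcases y with (y | y) | y <;> fin_cases x <;> fin_cases y <;>
      first
      | rfl
      | simp [rowPos₂, σ, M, Q, Y, Z, U, W, D₁, D₂, D₃, cat, genB₂]
  have hmul : fromBlocks (D₁ * Q * D₂) 0 0 (D₃ * Q * D₁) *
      fromRows (D₂ * J * D₁ * Y) (D₁ * J * D₃ * Z) = δ • fromRows Y Z := by
    have h := cat_mul_catAdj d g i j m o p r t u
    have h1 : D₁ * Q * D₂ * (D₂ * J * D₁ * Y) = δ • Y := by
      calc D₁ * Q * D₂ * (D₂ * J * D₁ * Y) = D₁ * (Q * ((D₂ * D₂) * J)) * D₁ * Y := by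
            simp only [Matrix.mul_assoc]
        _ = δ • Y := by simp [hD₂D₂, hQ, hJ, h, hD₁D₁, δ]
    have h2 : D₃ * Q * D₁ * (D₁ * J * D₃ * Z) = δ • Z := by
      calc D₃ * Q * D₁ * (D₁ * J * D₃ * Z) = D₃ * (Q * ((D₁ * D₁) * J)) * D₃ * Z := by
            simp only [Matrix.mul_assoc]
        _ = δ • Z := by simp [hD₁D₁, hQ, hJ, h, hD₃D₃, δ]
    rw [fromBlocks_mul_fromRows, h1, h2]
    ext (x | x) y <;> simp
  have hdiag : fromCols U W * fromRows (D₂ * J * D₁ * Y) (D₁ * J * D₃ * Z) =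
      !![-quintic3435 a b c d e f g h i j k l m n o p q r t u, 0;
        0, quintic3435 a b c d e f g h i j k l m n o p q r t u] := by
    have hUD : U * D₂ = !![-i, -h, -f, -c; g, f, e, b] := by
      ext x y
      fin_cases x <;> fin_cases y <;> simp [U, D₂]
    have hYD : D₁ * Y = !![-m, o; -l, n; -k, l; -e, f] := by
      ext x y
      fin_cases x <;> fin_cases y <;> simp [Y, D₁]
    have hWD : W * D₁ = !![-o, -n, -l, -f; m, l, k, e] := by
      ext x y
      fin_cases x <;> fin_cases y <;> simp [W, D₁]
    have hZD : D₃ * Z = !![g, -i; f, -h; e, -f; b, -c] := by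
      ext x y
      fin_cases x <;> fin_cases y <;> simp [Z, D₃]
    have hsplit : U * (D₂ * J * D₁ * Y) + W * (D₁ * J * D₃ * Z) =
        U * D₂ * J * (D₁ * Y) + W * D₁ * J * (D₃ * Z) := by
      simp only [Matrix.mul_assoc]
    rw [fromCols_mul_fromRows, hsplit, hUD, hYD, hWD, hZD]
    ext x y
    fin_cases x <;> fin_cases y <;>
      simp [J, catAdj] <;>
      (try simp only [quintic3435]) <;> ring
  have hschur := det_fromBlocks_mul_pow_card (fromBlocks (D₁ * Q * D₂) 0 0 (D₃ * Q * D₁))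
    (fromRows Y Z) (fromCols U W) 0 _ δ hmul
  rw [← hblocks, det_submatrix_equiv_self, det_permute', hsign, hdiag, Fintype.card_fin,
    det_fromBlocks_zero₂₁] at hschur
  refine mul_right_cancel₀ (pow_ne_zero 2 h0) ?_
  rw [Units.val_one, Int.cast_one, one_mul] at hschur
  rw [hschur]
  -- Since det D₁ = det D₂ = -1 and det D₃ = 1, the blocks contribute -δ²; the Schur complement is
  -- diagonal with entries ± the quintic and contributes the second minus sign.
  simp [det_fin_two, D₁, D₂, D₃, hQ, det_cat, Fin.prod_univ_succ]
  ring

/-! ### Cramer's rule for the bordered matrix. -/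

/-- Replacing the joining column by the image of a suitable vector makes the matrix block
triangular, with the truncated A and all of B, its first column scaled by y₀, on the diagonal. -/
theorem det_bordered_mul {R : Type*} [CommRing R] {n m : ℕ}
    (A : Matrix (Fin (n + 1)) (Fin (n + 1)) R) (A' : Matrix (Fin (m + 1)) (Fin (n + 1)) R)
    (B : Matrix (Fin (m + 1)) (Fin (m + 1)) R) (x : Fin (n + 1) → R) (y : Fin (m + 1) → R)
    (hx : A *ᵥ x = 0) (hy : B *ᵥ y = A' *ᵥ x) :
    (fromBlocks (A.submatrix Fin.castSucc Fin.castSucc)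
      (of fun i => Fin.cons (A i.castSucc (Fin.last n)) (0 : Fin m → R))
      (A'.submatrix id Fin.castSucc)
      (of fun i => Fin.cons (A' i (Fin.last n)) (B.submatrix id Fin.succ i))).det *
        x (Fin.last n) =
      (A.submatrix Fin.castSucc Fin.castSucc).det * (y 0 * B.det) := by
  set N := fromBlocks (A.submatrix Fin.castSucc Fin.castSucc)
      (of fun i => Fin.cons (A i.castSucc (Fin.last n)) (0 : Fin m → R))
      (A'.submatrix id Fin.castSucc)
      (of fun i => Fin.cons (A' i (Fin.last n)) (B.submatrix id Fin.succ i)) with hN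
  -- The tail of y is negated so that, in the lower rows, A'x - By cancels and only the omitted
  -- column of B, times y₀, survives.
  set z : Fin n ⊕ Fin (m + 1) → R :=
    Sum.elim (fun i => x i.castSucc) (Fin.cons (x (Fin.last n)) fun j => -y j.succ)
  have hz : N *ᵥ z = Sum.elim (0 : Fin n → R) (y 0 • fun i => B i 0) := by
    ext (i | i)
    · have := congrFun hx i.castSucc
      simp only [mulVec, dotProduct, Fin.sum_univ_castSucc, Pi.zero_apply] at this
      simpa [N, z, mulVec, dotProduct, Fin.sum_univ_succ (n := m)] using this
    · have := congrFun hy i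
      simp only [mulVec, dotProduct, Fin.sum_univ_castSucc (n := n),
        Fin.sum_univ_succ (n := m)] at this
      simp [N, z, mulVec, dotProduct, Fin.sum_univ_succ (n := m)]
      linear_combination -this
  -- Cramer's rule in the form adj(N)·N·z = det(N)·z, read at the entry of z that holds the last
  -- coordinate of x; no invertibility of N is needed.
  have hcramer : (N.updateCol (Sum.inr 0) (N *ᵥ z)).det = N.det * x (Fin.last n) := by
    rw [← cramer_apply, cramer_eq_adjugate_mulVec, mulVec_mulVec, adjugate_mul]
    simp [z, smul_mulVec]
  have hblocks : N.updateCol (Sum.inr 0) (N *ᵥ z) =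
      fromBlocks (A.submatrix Fin.castSucc Fin.castSucc) 0 (A'.submatrix id Fin.castSucc)
        (B.updateCol 0 (y 0 • fun i => B i 0)) := by
    rw [hz]
    ext (i | i) (j | j)
    · simp [N]
    · refine Fin.cases ?_ (fun j => ?_) j <;> simp [N]
    · simp [N]
    · refine Fin.cases ?_ (fun j => ?_) j <;> simp [N]
  rw [← hcramer, hblocks, det_fromBlocks_zero₁₂, det_updateCol_smul, updateCol_eq_self]

/-! ### Specialization to the coordinates `s_α`. -/

theorem map_genGb {R T F : Type*} [CommRing R] [CommRing T] [FunLike F R T]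
    [RingHomClass F R T] (φ : F) (a b c d e f g h i j k l m n o p q r t u : R) :
    φ (genGb a b c d e f g h i j k l m n o p q r t u) =
      genGb (φ a) (φ b) (φ c) (φ d) (φ e) (φ f) (φ g) (φ h) (φ i) (φ j)
        (φ k) (φ l) (φ m) (φ n) (φ o) (φ p) (φ q) (φ r) (φ t) (φ u) := by
  simp only [genGb, map_add, map_sub, map_neg, map_mul, map_pow, map_ofNat]

theorem phi_swap_s (a b c d : ℕ) (h : a + b + c + d = 3) :
    phi (Equiv.swap 1 2) (s a b c d h) = s a c b d (by omega) := by
  simp only [phi, s, MvPolynomial.rename_X]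
  congr 2
  ext x
  fin_cases x <;> rfl

theorem A₁_eq_genA₁ : A₁ = genA₁
    (s 3 0 0 0) (s 2 1 0 0) (s 2 0 1 0) (s 2 0 0 1) (s 1 2 0 0) (s 1 1 1 0) (s 1 1 0 1)
    (s 1 0 2 0) (s 1 0 1 1) (s 1 0 0 2) (s 0 3 0 0) (s 0 2 1 0) (s 0 2 0 1) (s 0 1 2 0)
    (s 0 1 1 1) (s 0 1 0 2) (s 0 0 3 0) (s 0 0 2 1) (s 0 0 1 2) (s 0 0 0 3) := rfl

theorem A₂_eq_genA₂ : A₂ = genA₂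
    (s 3 0 0 0) (s 2 1 0 0) (s 2 0 1 0) (s 2 0 0 1) (s 1 2 0 0) (s 1 1 1 0) (s 1 1 0 1)
    (s 1 0 2 0) (s 1 0 1 1) (s 1 0 0 2) (s 0 3 0 0) (s 0 2 1 0) (s 0 2 0 1) (s 0 1 2 0)
    (s 0 1 1 1) (s 0 1 0 2) (s 0 0 3 0) (s 0 0 2 1) (s 0 0 1 2) (s 0 0 0 3) := rfl

theorem B₂_eq_genB₂ : B₂ = genB₂
    (s 3 0 0 0) (s 2 1 0 0) (s 2 0 1 0) (s 2 0 0 1) (s 1 2 0 0) (s 1 1 1 0) (s 1 1 0 1)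
    (s 1 0 2 0) (s 1 0 1 1) (s 1 0 0 2) (s 0 3 0 0) (s 0 2 1 0) (s 0 2 0 1) (s 0 1 2 0)
    (s 0 1 1 1) (s 0 1 0 2) (s 0 0 3 0) (s 0 0 2 1) (s 0 0 1 2) (s 0 0 0 3) := rfl

theorem G_eq_genG : G = genG
    (s 3 0 0 0) (s 2 1 0 0) (s 2 0 1 0) (s 2 0 0 1) (s 1 2 0 0) (s 1 1 1 0) (s 1 1 0 1)
    (s 1 0 2 0) (s 1 0 1 1) (s 1 0 0 2) (s 0 3 0 0) (s 0 2 1 0) (s 0 2 0 1) (s 0 1 2 0)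
    (s 0 1 1 1) (s 0 1 0 2) (s 0 0 3 0) (s 0 0 2 1) (s 0 0 1 2) (s 0 0 0 3) := by
  have hξ : ξ = genXi
      (s 3 0 0 0) (s 2 1 0 0) (s 2 0 1 0) (s 2 0 0 1) (s 1 2 0 0) (s 1 1 1 0) (s 1 1 0 1)
      (s 1 0 2 0) (s 1 0 1 1) (s 1 0 0 2) (s 0 3 0 0) (s 0 2 1 0) (s 0 2 0 1) (s 0 1 2 0)
      (s 0 1 1 1) (s 0 1 0 2) (s 0 0 3 0) (s 0 0 2 1) (s 0 0 1 2) (s 0 0 0 3) := by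
    rw [ξ, A₁_eq_genA₁, pf_genA₁_submatrix]
  have hGa : Ga = genGa
      (s 3 0 0 0) (s 2 1 0 0) (s 2 0 1 0) (s 2 0 0 1) (s 1 2 0 0) (s 1 1 1 0) (s 1 1 0 1)
      (s 1 0 2 0) (s 1 0 1 1) (s 1 0 0 2) (s 0 3 0 0) (s 0 2 1 0) (s 0 2 0 1) (s 0 1 2 0)
      (s 0 1 1 1) (s 0 1 0 2) (s 0 0 3 0) (s 0 0 2 1) (s 0 0 1 2) (s 0 0 0 3) := rfl
  have hGb : Gb = genGb
      (s 3 0 0 0) (s 2 1 0 0) (s 2 0 1 0) (s 2 0 0 1) (s 1 2 0 0) (s 1 1 1 0) (s 1 1 0 1)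
      (s 1 0 2 0) (s 1 0 1 1) (s 1 0 0 2) (s 0 3 0 0) (s 0 2 1 0) (s 0 2 0 1) (s 0 1 2 0)
      (s 0 1 1 1) (s 0 1 0 2) (s 0 0 3 0) (s 0 0 2 1) (s 0 0 1 2) (s 0 0 0 3) := rfl
  simp only [G, genG, hξ, hGa, hGb, map_genGb, phi_swap_s]

theorem pf_At₁ : pf 5 At₁ = quintic3435
    (s 3 0 0 0) (s 2 1 0 0) (s 2 0 1 0) (s 2 0 0 1) (s 1 2 0 0) (s 1 1 1 0) (s 1 1 0 1)
    (s 1 0 2 0) (s 1 0 1 1) (s 1 0 0 2) (s 0 3 0 0) (s 0 2 1 0) (s 0 2 0 1) (s 0 1 2 0)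
    (s 0 1 1 1) (s 0 1 0 2) (s 0 0 3 0) (s 0 0 2 1) (s 0 0 1 2) (s 0 0 0 3) := by
  rw [At₁, A₁_eq_genA₁, pf_genA₁]

/-- The coordinates of a point at which neither `pf 5 At₁` nor `catDet` vanishes. -/
def testPoint : ℕ → ℕ → ℕ → ℂ
  | 0, 0, 0 => 1
  | 0, 2, 0 => 1
  | 1, 0, 1 => 1
  | 1, 0, 2 => 1
  | 1, 2, 0 => 1
  | _, _, _ => 0

theorem eval_testPoint_s (a b c d : ℕ) (h : a + b + c + d = 3) :
    MvPolynomial.eval (fun α : Index => testPoint (α.1 0) (α.1 1) (α.1 2)) (s a b c d h) =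
      testPoint a b c := by
  simp [s]

theorem pf_At₁_ne_zero : pf 5 At₁ ≠ 0 := by
  intro h
  have := congrArg (MvPolynomial.eval fun α : Index => testPoint (α.1 0) (α.1 1) (α.1 2)) h
  rw [pf_At₁] at this
  simp only [quintic3435, map_add, map_sub, map_neg, map_mul, map_pow, map_ofNat, map_zero,
    eval_testPoint_s] at this
  -- The nonzero coordinates are s₀₀₀₃, s₀₂₀₁, s₁₀₁₁, s₁₀₂₀ and s₁₂₀₀, all equal to 1; the Pfaffian
  -- takes the value 2 there.
  simp [testPoint] at this

theorem catDet_s_ne_zero : catDet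
    (s 2 0 0 1) (s 1 1 0 1) (s 1 0 1 1) (s 1 0 0 2) (s 0 2 0 1) (s 0 1 1 1) (s 0 1 0 2)
    (s 0 0 2 1) (s 0 0 1 2) (s 0 0 0 3) ≠ 0 := by
  intro h
  have := congrArg (MvPolynomial.eval fun α : Index => testPoint (α.1 0) (α.1 1) (α.1 2)) h
  simp only [catDet, map_add, map_sub, map_neg, map_mul, map_zero, eval_testPoint_s] at this
  -- The catalecticant determinant takes the value -1 at the same point.
  simp [testPoint] at this

/-! ### The determinant of `L` and the conclusion. -/

theorem eq_neg_div_of_eq_neg_mul {K : Type*} [Field K] {x w v : K} (hv : v ≠ 0)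
    (h : w = -(x * v)) : x = -(w / v) := by
  rw [h, neg_div, neg_neg, mul_div_cancel_right₀ _ hv]

theorem det_L : L.det = -(G * pf 5 At₁ ^ 3) := by
  have hL := det_bordered_mul A₁ A₂ B₂ _ _
    (A₁_eq_genA₁ ▸ genA₁_mulVec_kernelA₁
      (s 3 0 0 0) (s 2 1 0 0) (s 2 0 1 0) (s 2 0 0 1) (s 1 2 0 0) (s 1 1 1 0) (s 1 1 0 1)
      (s 1 0 2 0) (s 1 0 1 1) (s 1 0 0 2) (s 0 3 0 0) (s 0 2 1 0) (s 0 2 0 1) (s 0 1 2 0)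
      (s 0 1 1 1) (s 0 1 0 2) (s 0 0 3 0) (s 0 0 2 1) (s 0 0 1 2) (s 0 0 0 3))
    (B₂_eq_genB₂ ▸ A₂_eq_genA₂ ▸ genB₂_mulVec_liftB₂
      (s 3 0 0 0) (s 2 1 0 0) (s 2 0 1 0) (s 2 0 0 1) (s 1 2 0 0) (s 1 1 1 0) (s 1 1 0 1)
      (s 1 0 2 0) (s 1 0 1 1) (s 1 0 0 2) (s 0 3 0 0) (s 0 2 1 0) (s 0 2 0 1) (s 0 1 2 0)
      (s 0 1 1 1) (s 0 1 0 2) (s 0 0 3 0) (s 0 0 2 1) (s 0 0 1 2) (s 0 0 0 3))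
  have hA : (A₁.submatrix Fin.castSucc Fin.castSucc).det = pf 5 At₁ ^ 2 := by
    rw [pf_At₁, A₁_eq_genA₁]
    exact det_genA₁ _ _ _ _ _ _ _ _ _ _ _ _ _ _ _ _ _ _ _ _ catDet_s_ne_zero
  have hB : B₂.det = pf 5 At₁ ^ 2 := by
    rw [pf_At₁, B₂_eq_genB₂]
    exact det_genB₂ _ _ _ _ _ _ _ _ _ _ _ _ _ _ _ _ _ _ _ _ catDet_s_ne_zero
  have hlast : kernelA₁
      (s 3 0 0 0) (s 2 1 0 0) (s 2 0 1 0) (s 2 0 0 1) (s 1 2 0 0) (s 1 1 1 0) (s 1 1 0 1)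
      (s 1 0 2 0) (s 1 0 1 1) (s 1 0 0 2) (s 0 3 0 0) (s 0 2 1 0) (s 0 2 0 1) (s 0 1 2 0)
      (s 0 1 1 1) (s 0 1 0 2) (s 0 0 3 0) (s 0 0 2 1) (s 0 0 1 2) (s 0 0 0 3)
      (Fin.last 10) = pf 5 At₁ := by
    rw [pf_At₁]
    rfl
  have hzero : liftB₂
      (s 3 0 0 0) (s 2 1 0 0) (s 2 0 1 0) (s 2 0 0 1) (s 1 2 0 0) (s 1 1 1 0) (s 1 1 0 1)
      (s 1 0 2 0) (s 1 0 1 1) (s 1 0 0 2) (s 0 3 0 0) (s 0 2 1 0) (s 0 2 0 1) (s 0 1 2 0)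
      (s 0 1 1 1) (s 0 1 0 2) (s 0 0 3 0) (s 0 0 2 1) (s 0 0 1 2) (s 0 0 0 3) 0 = -G := by
    rw [G_eq_genG]
    rfl
  rw [hlast, hzero, hA, hB] at hL
  -- Cramer's rule has given det(L)·Pf = Pf²·(-G·Pf²); one factor Pf is cancelled in the domain `S`.
  refine mul_right_cancel₀ pf_At₁_ne_zero (Eq.trans hL ?_)
  ring

end VeroneseSecant

theorem proposition3p9 :
    VeroneseSecant.pf 5 VeroneseSecant.At₁ ≠ 0 ∧
    algebraMap VeroneseSecant.S (FractionRing VeroneseSecant.S) VeroneseSecant.G =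
      -(algebraMap VeroneseSecant.S (FractionRing VeroneseSecant.S) VeroneseSecant.L.det /
        algebraMap VeroneseSecant.S (FractionRing VeroneseSecant.S)
          (VeroneseSecant.pf 5 VeroneseSecant.At₁) ^ 3) := by
  refine ⟨VeroneseSecant.pf_At₁_ne_zero, ?_⟩
  have h : algebraMap VeroneseSecant.S (FractionRing VeroneseSecant.S)
      (VeroneseSecant.pf 5 VeroneseSecant.At₁) ≠ 0 :=
    (map_ne_zero_iff _ (IsFractionRing.injective _ _)).2 VeroneseSecant.pf_At₁_ne_zero
  have hdet := congrArg (algebraMap VeroneseSecant.S (FractionRing VeroneseSecant.S))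
    VeroneseSecant.det_L
  rw [map_neg, map_mul, map_pow] at hdet
  exact VeroneseSecant.eq_neg_div_of_eq_neg_mul (pow_ne_zero 3 h) hdet
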